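/- For a semigroup $M$, $t\ge 1$, and elements $x_1,\dots,x_t,z_1,z_2,\dots\in M$ define $\lambda_{n,i}=\lambda_{n,i}(x_1,\dots,x_t;z_1,\dots,z_n)$ for $n\ge 0$, $1\le i\le t$ by $\lambda_{0,i}=x_i$ and $$\lambda_{n+1,i}=\lambda_{n,i}\,z_{n+1}\,\lambda_{n,i+1}\,z_{n+1}\cdots\lambda_{n,t}\,z_{n+1}\,\lambda_{n,1}\,z_{n+1}\cdots\lambda_{n,i-1}.$$ A semigroup $S$ is *strongly Mal'cev nilpotent* if there is a positive integer $n$ such that, for all $t\ge 1$, all $x_1,\dots,x_t\in S$ and all $z_1,\dots,z_n\in S^1$, $$\lambda_{n,1}(x_1,\dots,x_t;z_1,\dots,z_n)=\cdots=\lambda_{n,t}(x_1,\dots,x_t;z_1,\dots,z_n).$$ Let $\mathsf{SMN}$ be the class of all finite strongly Mal'cev nilpotent semigroups. For $t\ge 2$ let $F_t$ be the free profinite semigroup on $\{y_1,\dots,y_t,z_1,\dots,z_t\}$, let $\phi_t$ be the continuous endomorphism of $F_t$ with $\phi_t(y_i)=\lambda_{t,i}(y_1,\dots,y_t;z_1,\dots,z_t)$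 and $\phi_t(z_i)=z_i$ for $1\le i\le t$, and let $\phi_t^\omega(u)=\lim_{n\to\infty}\phi_t^{n!}(u)$ for $u\in F_t$. Let $\mathsf{SMN}^\circ_t=[\![\,\phi_t^\omega(y_1)=\cdots=\phi_t^\omega(y_t)\,]\!]$ be the class (a pseudovariety) of all finite semigroups that satisfy these pseudoidentities, where a finite semigroup $S$ satisfies $u=v$ if $\psi(u)=\psi(v)$ for every continuous homomorphism $\psi\colon F_t\to S$. **Theorem.** $\displaystyle \mathsf{SMN}=\bigcap_{t\ge 2}\mathsf{SMN}^\circ_t$. -/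

import Mathlib

universe u v

/-! ### The words `λ_{n,i}` and strong Mal'cev nilpotency -/

/-- `interleave a z i k` is the product `a_i z a_{i+1} z ⋯ z a_{i+k}`,
the indices being taken modulo `t`. -/
def interleave {M : Type u} [Semigroup M] {t : ℕ} (a : Fin t → M) (z : M) (i : Fin t) : ℕ → M
  | 0 => a i
  | k + 1 => interleave a z i k * z * a ⟨((i : ℕ) + (k + 1)) % t, Nat.mod_lt _ i.pos⟩

/-- The elements `λ_{n,i}(x_1,…,x_t; z_1,…,z_n)`: `λ_{0,i} = x_i` and
`λ_{n+1,i} = λ_{n,i} z_{n+1} λ_{n,i+1} z_{n+1} ⋯ λ_{n,t} z_{n+1} λ_{n,1} z_{n+1} ⋯ λ_{n,i-1}`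
(a product of the `t` elements `λ_{n,j}`, in cyclic order starting at `j = i`, separated by
`z_{n+1}`). The indices `1,…,t` and `1,…,n` are here `0,…,t-1` and `0,…,n-1`. -/
def malcevLambda {M : Type u} [Semigroup M] {t : ℕ} (x : Fin t → M) :
    (n : ℕ) → (Fin n → M) → Fin t → M
  | 0, _, i => x i
  | n + 1, z, i =>
      interleave (malcevLambda x n fun k => z k.castSucc) (z (Fin.last n)) i (t - 1)

/-- Strong Mal'cev nilpotency: for some `n ≥ 1` and all `t`, the elements
`λ_{n,1}(x; z), …, λ_{n,t}(x; z)` coincide for all `x_1,…,x_t ∈ S` and `z_1,…,z_n ∈ S¹`.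
The products are computed in `WithOne S`, which contains `S`, and whose identity acts on `S` in the
same way as the identity of `S¹` does (also when `S` itself has an identity). -/
def IsStronglyMalcevNilpotent (S : Type u) [Semigroup S] : Prop :=
  ∃ n : ℕ, 0 < n ∧ ∀ (t : ℕ) (x : Fin t → S) (z : Fin n → WithOne S) (i j : Fin t),
    malcevLambda (fun k => (x k : WithOne S)) n z i
      = malcevLambda (fun k => (x k : WithOne S)) n z j

/-- Finite semigroups. -/
structure FiniteSemigroup : Type (u + 1) where
  /-- the underlying set -/
  carrier : Type u
  [semigroup : Semigroup carrier]
  [finite : Finite carrier]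

attribute [instance] FiniteSemigroup.semigroup FiniteSemigroup.finite

/-- The class of all finite strongly Mal'cev nilpotent semigroups. -/
def SMN : Set FiniteSemigroup.{u} := {S | IsStronglyMalcevNilpotent S.carrier}

/-! ### The free profinite semigroup -/

/-- The congruences of finite index on the free semigroup on `A`. -/
abbrev FinIndexCon (A : Type u) : Type u :=
  {c : Con (FreeSemigroup A) // Finite c.Quotient}

/-- The free profinite semigroup on `A`: the projective limit of the finite quotients of the free
semigroup on `A`, that is, the set of all families of elements of these quotients that are
compatible with the canonical maps from the quotient by `c` onto the quotient by `d`, `c ≤ d`. -/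
@[ext]
structure FreeProfiniteSemigroup (A : Type u) : Type u where
  /-- the components of the family -/
  proj : (c : FinIndexCon A) → c.1.Quotient
  compat : ∀ c d : FinIndexCon A, c.1 ≤ d.1 → ∀ w : FreeSemigroup A,
    proj c = (w : c.1.Quotient) → proj d = (w : d.1.Quotient)

namespace FreeProfiniteSemigroup

variable {A B : Type u} {S : Type v} {T : Type v} [Semigroup S] [Finite S] [Semigroup T] [Finite T]

theorem exists_word (x : FreeProfiniteSemigroup A) (c : FinIndexCon A) :
    ∃ w : FreeSemigroup A, x.proj c = (w : c.1.Quotient) := by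
  obtain ⟨w, hw⟩ := Quotient.exists_rep (x.proj c)
  exact ⟨w, hw.symm⟩

instance : Mul (FreeProfiniteSemigroup A) where
  mul x y :=
    { proj := fun c => x.proj c * y.proj c
      compat := by
        intro c d h w hw
        obtain ⟨a, ha⟩ := x.exists_word c
        obtain ⟨b, hb⟩ := y.exists_word c
        rw [x.compat c d h a ha, y.compat c d h b hb, ← Con.coe_mul, Con.eq]
        rw [ha, hb, ← Con.coe_mul, Con.eq] at hw
        exact h hw }

@[simp]
theorem proj_mul (x y : FreeProfiniteSemigroup A) (c : FinIndexCon A) :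
    (x * y).proj c = x.proj c * y.proj c := rfl

instance : Semigroup (FreeProfiniteSemigroup A) where
  mul_assoc x y z := by
    ext c
    simp [mul_assoc]

/-- The canonical homomorphism from the free semigroup to the free profinite semigroup. -/
def ofWord : FreeSemigroup A →ₙ* FreeProfiniteSemigroup A where
  toFun w :=
    { proj := fun c => (w : c.1.Quotient)
      compat := by
        intro c d h w' hw
        rw [Con.eq] at hw ⊢
        exact h hw }
  map_mul' _ _ := rfl

@[simp]
theorem proj_ofWord (w : FreeSemigroup A) (c : FinIndexCon A) :
    (ofWord w).proj c = (w : c.1.Quotient) := rfl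

/-- The free generators. -/
def of (a : A) : FreeProfiniteSemigroup A := ofWord (FreeSemigroup.of a)

/-- The profinite topology: the coarsest one for which the projections to the finite quotients,
taken with the discrete topology, are continuous. -/
instance : TopologicalSpace (FreeProfiniteSemigroup A) :=
  ⨅ c : FinIndexCon A, TopologicalSpace.induced (fun x => x.proj c) ⊥

/-! #### Extension of a map `A → S` into a finite semigroup -/

/-- The kernel of the homomorphism from the free semigroup to `S` that extends `ψ : A → S`. -/
def kerCon (ψ : A → S) : FinIndexCon A :=
  ⟨Con.ker (FreeSemigroup.lift ψ), by
    refine Finite.of_injective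
      (fun q : (Con.ker (FreeSemigroup.lift ψ)).Quotient =>
        Con.liftOn q (FreeSemigroup.lift ψ) fun _ _ h => h) ?_
    intro p q
    refine Quotient.inductionOn₂ p q fun a b h => ?_
    exact Quotient.sound h⟩

/-- The value in `S` of the `ψ`-component of an element of the free profinite semigroup. -/
def evalFun (ψ : A → S) (x : FreeProfiniteSemigroup A) : S :=
  Con.liftOn (x.proj (kerCon ψ)) (FreeSemigroup.lift ψ) fun _ _ h => h

theorem evalFun_eq (ψ : A → S) (x : FreeProfiniteSemigroup A) (w : FreeSemigroup A)
    (h : x.proj (kerCon ψ) = (w : (kerCon ψ).1.Quotient)) :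
    evalFun ψ x = FreeSemigroup.lift ψ w := by
  unfold evalFun
  rw [h]
  rfl

/-- The continuous homomorphism from the free profinite semigroup on `A` to the finite semigroup `S`
that extends the map `ψ : A → S`. -/
def eval (ψ : A → S) : FreeProfiniteSemigroup A →ₙ* S where
  toFun := evalFun ψ
  map_mul' x y := by
    obtain ⟨a, ha⟩ := x.exists_word (kerCon ψ)
    obtain ⟨b, hb⟩ := y.exists_word (kerCon ψ)
    rw [evalFun_eq ψ x a ha, evalFun_eq ψ y b hb, evalFun_eq ψ (x * y) (a * b), map_mul]
    rw [proj_mul, ha, hb, Con.coe_mul]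

theorem eval_ofWord (ψ : A → S) (w : FreeSemigroup A) :
    eval ψ (ofWord w) = FreeSemigroup.lift ψ w := evalFun_eq ψ (ofWord w) w rfl

@[simp]
theorem eval_of (ψ : A → S) (a : A) : eval ψ (of a) = ψ a := by
  rw [of, eval_ofWord, FreeSemigroup.lift_of]

theorem eval_eq_of_le (ψ : A → S) (x : FreeProfiniteSemigroup A) (c : FinIndexCon A)
    (hc : c.1 ≤ (kerCon ψ).1) (w : FreeSemigroup A) (h : x.proj c = (w : c.1.Quotient)) :
    eval ψ x = FreeSemigroup.lift ψ w :=
  evalFun_eq ψ x w (x.compat c _ hc w h)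

theorem map_eval (h : S →ₙ* T) (ψ : A → S) (x : FreeProfiniteSemigroup A) :
    h (eval ψ x) = eval (fun a => h (ψ a)) x := by
  have key : h.comp (FreeSemigroup.lift ψ) = FreeSemigroup.lift fun a => h (ψ a) := by
    apply FreeSemigroup.hom_ext
    funext a
    simp
  obtain ⟨w, hw⟩ := x.exists_word (kerCon ψ)
  have hle : (kerCon ψ).1 ≤ (kerCon fun a => h (ψ a)).1 := by
    intro a b hab
    change FreeSemigroup.lift (fun a => h (ψ a)) a = FreeSemigroup.lift (fun a => h (ψ a)) b
    rw [← key]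
    exact congrArg h hab
  rw [eval_eq_of_le ψ x _ le_rfl w hw, eval_eq_of_le _ x _ hle w hw, ← key]
  rfl

instance (c : FinIndexCon A) : Finite c.1.Quotient := c.2

/-- The projections are the extensions of their restrictions to the free generators. -/
theorem proj_eq_eval (x : FreeProfiniteSemigroup A) (c : FinIndexCon A) :
    x.proj c = eval (fun a => (of a).proj c) x := by
  have key : Con.mkMulHom c.1 = FreeSemigroup.lift fun a => (of a).proj c := by
    apply FreeSemigroup.hom_ext
    funext a
    rfl
  obtain ⟨w, hw⟩ := x.exists_word c
  rw [eval_eq_of_le _ x c ?_ w hw, hw, ← key]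
  · rfl
  · intro a b hab
    change FreeSemigroup.lift _ a = FreeSemigroup.lift _ b
    rw [← key]
    exact (Con.eq c.1).mpr hab

/-! #### The profinite topology and the universal property -/

theorem nhds_eq_iInf (x : FreeProfiniteSemigroup A) :
    nhds x = ⨅ c : FinIndexCon A, Filter.principal {y | y.proj c = x.proj c} := by
  rw [nhds_iInf]
  refine iInf_congr fun c => ?_
  let _ : TopologicalSpace c.1.Quotient := ⊥
  have : DiscreteTopology c.1.Quotient := ⟨rfl⟩
  rw [nhds_induced, nhds_discrete]
  change Filter.comap _ (pure _) = _
  rw [← Filter.principal_singleton, Filter.comap_principal]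
  rfl

theorem tendsto_iff {ι : Type v} {l : Filter ι} {g : ι → FreeProfiniteSemigroup A}
    {x : FreeProfiniteSemigroup A} :
    Filter.Tendsto g l (nhds x) ↔ ∀ c : FinIndexCon A, ∀ᶠ n in l, (g n).proj c = x.proj c := by
  rw [nhds_eq_iInf, Filter.tendsto_iInf]
  simp only [Filter.tendsto_principal, Set.mem_ofPred_eq]

theorem proj_mem_nhds (x : FreeProfiniteSemigroup A) (c : FinIndexCon A) :
    {y | y.proj c = x.proj c} ∈ nhds x := by
  rw [nhds_eq_iInf]
  exact Filter.mem_iInf_of_mem c (Filter.mem_principal_self _)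

instance : T2Space (FreeProfiniteSemigroup A) := by
  rw [t2Space_iff_disjoint_nhds]
  intro x y hxy
  obtain ⟨c, hc⟩ : ∃ c, x.proj c ≠ y.proj c := by
    by_contra h
    push Not at h
    exact hxy (FreeProfiniteSemigroup.ext (funext h))
  refine Filter.disjoint_iff.mpr ⟨_, proj_mem_nhds x c, _, proj_mem_nhds y c, ?_⟩
  rw [Set.disjoint_left]
  intro z hx hy
  exact hc (hx.symm.trans hy)

/-- The intersection of two congruences of finite index. -/
def infCon (c d : FinIndexCon A) : FinIndexCon A :=
  ⟨c.1 ⊓ d.1, by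
    refine Finite.of_injective
      (fun q : (c.1 ⊓ d.1).Quotient =>
        (Con.liftOn q (fun w => ((w : c.1.Quotient), (w : d.1.Quotient)))
          fun a b h => Prod.ext ((Con.eq c.1).mpr h.1) ((Con.eq d.1).mpr h.2) :
          c.1.Quotient × d.1.Quotient)) ?_
    intro p q
    refine Quotient.inductionOn₂ p q fun a b h => ?_
    exact Quotient.sound ⟨(Con.eq c.1).mp (congrArg Prod.fst h),
      (Con.eq d.1).mp (congrArg Prod.snd h)⟩⟩

theorem exists_proj_subset {x : FreeProfiniteSemigroup A} {U : Set (FreeProfiniteSemigroup A)}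
    (hU : U ∈ nhds x) : ∃ c : FinIndexCon A, {y | y.proj c = x.proj c} ⊆ U := by
  have mono : ∀ c d : FinIndexCon A, c.1 ≤ d.1 →
      {y : FreeProfiniteSemigroup A | y.proj c = x.proj c} ⊆ {y | y.proj d = x.proj d} := by
    intro c d h y hy
    obtain ⟨w, hw⟩ := x.exists_word c
    exact (y.compat c d h w (hy.trans hw)).trans (x.compat c d h w hw).symm
  have : Nonempty (FinIndexCon A) := ⟨kerCon (S := PUnit.{1}) fun _ => PUnit.unit⟩
  rw [nhds_eq_iInf, Filter.mem_iInf_of_directed] at hU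
  · simpa using hU
  · intro c d
    refine ⟨infCon c d, ?_, ?_⟩
    · exact Filter.principal_mono.mpr (mono _ _ inf_le_left)
    · exact Filter.principal_mono.mpr (mono _ _ inf_le_right)

theorem continuous_eval [TopologicalSpace S] (ψ : A → S) : Continuous (eval ψ) := by
  rw [continuous_iff_continuousAt]
  intro x
  refine Filter.Tendsto.mono_right ?_ (pure_le_nhds _)
  rw [Filter.tendsto_pure]
  filter_upwards [proj_mem_nhds x (kerCon ψ)] with y hy
  change Con.liftOn _ _ _ = Con.liftOn _ _ _
  rw [Set.mem_ofPred_eq.mp hy]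

/-- Every continuous homomorphism into a finite discrete semigroup is of the form `eval ψ`. -/
theorem eq_eval_of_continuous [TopologicalSpace S] [DiscreteTopology S]
    (h : FreeProfiniteSemigroup A →ₙ* S) (hc : Continuous h) : h = eval fun a => h (of a) := by
  ext x
  obtain ⟨c, hc⟩ := exists_proj_subset (hc.continuousAt.preimage_mem_nhds
    (mem_nhds_discrete.mpr (Set.mem_singleton (h x))))
  have key : h.comp ofWord = FreeSemigroup.lift fun a => h (of a) := by
    apply FreeSemigroup.hom_ext
    funext a
    simp [of]
  obtain ⟨w, hw⟩ := x.exists_word (infCon c (kerCon fun a => h (of a)))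
  have h1 : h (ofWord w) = h x := hc (x.compat _ c inf_le_left w hw).symm
  rw [eval_eq_of_le _ x _ inf_le_right w hw, ← key, ← h1]
  rfl

/-! #### Endomorphisms -/

/-- The continuous homomorphism between free profinite semigroups that sends `of a` to `f a`. -/
def lift (f : A → FreeProfiniteSemigroup B) :
    FreeProfiniteSemigroup A →ₙ* FreeProfiniteSemigroup B where
  toFun x :=
    { proj := fun c => eval (fun a => (f a).proj c) x
      compat := by
        intro c d hcd w hw
        let h : c.1.Quotient →ₙ* d.1.Quotient :=
          { toFun := fun q =>
              Con.liftOn q (fun w => (w : d.1.Quotient)) fun a b hab => (Con.eq d.1).mpr (hcd hab)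
            map_mul' := by
              intro p q
              refine Quotient.inductionOn₂ p q fun a b => ?_
              rfl }
        have hf : (fun a => (f a).proj d) = fun a => h ((f a).proj c) := by
          funext a
          obtain ⟨v, hv⟩ := (f a).exists_word c
          rw [(f a).compat c d hcd v hv, hv]
          rfl
        rw [hf, ← map_eval, hw]
        rfl }
  map_mul' x y := by
    ext c
    simp

@[simp]
theorem proj_lift (f : A → FreeProfiniteSemigroup B) (x : FreeProfiniteSemigroup A)
    (c : FinIndexCon B) : (lift f x).proj c = eval (fun a => (f a).proj c) x := rfl

@[simp]
theorem lift_of (f : A → FreeProfiniteSemigroup B) (a : A) : lift f (of a) = f a := by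
  ext c
  simp

theorem continuous_lift (f : A → FreeProfiniteSemigroup B) : Continuous (lift f) := by
  rw [continuous_iff_continuousAt]
  intro x
  rw [ContinuousAt, tendsto_iff]
  intro c
  let _ : TopologicalSpace c.1.Quotient := ⊥
  have : DiscreteTopology c.1.Quotient := ⟨rfl⟩
  exact (continuous_eval fun a => (f a).proj c).continuousAt.preimage_mem_nhds
    (mem_nhds_discrete.mpr (Set.mem_singleton _))

theorem eval_lift (ψ : B → S) (f : A → FreeProfiniteSemigroup B) (x : FreeProfiniteSemigroup A) :
    eval ψ (lift f x) = eval (fun a => eval ψ (f a)) x := by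
  let _ : TopologicalSpace S := ⊥
  have : DiscreteTopology S := ⟨rfl⟩
  have h := eq_eval_of_continuous ((eval ψ).comp (lift f))
    ((continuous_eval ψ).comp (continuous_lift f))
  simpa using DFunLike.congr_fun h x

/-- Every continuous homomorphism between free profinite semigroups is of the form `lift f`. -/
theorem eq_lift_of_continuous (h : FreeProfiniteSemigroup A →ₙ* FreeProfiniteSemigroup B)
    (hc : Continuous h) : h = lift fun a => h (of a) := by
  ext x c
  let _ : TopologicalSpace c.1.Quotient := ⊥
  have : DiscreteTopology c.1.Quotient := ⟨rfl⟩
  have key := eq_eval_of_continuous ((eval fun b => (of b).proj c).comp h)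
    ((continuous_eval _).comp hc)
  have := DFunLike.congr_fun key x
  simpa [← proj_eq_eval] using this

/-! #### Powers of endomorphisms, pseudoidentities -/

/-- `φ^ω(x) = lim φ^{n!}(x)` for a continuous endomorphism `φ`. -/
noncomputable def omegaPow (φ : FreeProfiniteSemigroup A →ₙ* FreeProfiniteSemigroup A)
    (x : FreeProfiniteSemigroup A) : FreeProfiniteSemigroup A :=
  haveI : Nonempty (FreeProfiniteSemigroup A) := ⟨x⟩
  Filter.limUnder Filter.atTop fun n : ℕ => φ^[n.factorial] x

theorem eventually_iterate_factorial {X : Type u} [Finite X] (T : X → X) :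
    ∃ N : ℕ, ∀ n ≥ N, T^[n.factorial] = T^[N.factorial] := by
  obtain ⟨i, j, hij, h⟩ := Finite.exists_ne_map_eq_of_infinite fun n : ℕ => T^[n]
  wlog hlt : i < j generalizing i j
  · exact this j i hij.symm h.symm (by omega)
  have hper : ∀ m ≥ i, ∀ k, T^[m + k * (j - i)] = T^[m] := by
    intro m hm k
    induction k with
    | zero => simp
    | succ k ih =>
      have e1 : m + (k + 1) * (j - i) = (m - i + k * (j - i)) + j := by
        rw [Nat.succ_mul]; omega
      have e2 : m + k * (j - i) = (m - i + k * (j - i)) + i := by omega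
      rw [e1, Function.iterate_add, ← h, ← Function.iterate_add, ← e2, ih]
  refine ⟨j, fun n hn => ?_⟩
  have hd : (j - i) ∣ j.factorial := Nat.dvd_factorial (by omega) (by omega)
  obtain ⟨q, hq⟩ := Nat.dvd_sub (hd.trans (Nat.factorial_dvd_factorial hn)) hd
  have hle := Nat.factorial_le hn
  have hj := Nat.self_le_factorial j
  have : n.factorial = j.factorial + q * (j - i) := by
    rw [mul_comm, ← hq]; omega
  rw [this]
  exact hper _ (by omega) q

/-- The limit that defines `φ^ω(x)` exists. -/
theorem tendsto_omegaPow [Finite A] (φ : FreeProfiniteSemigroup A →ₙ* FreeProfiniteSemigroup A)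
    (hφ : Continuous φ) (x : FreeProfiniteSemigroup A) :
    Filter.Tendsto (fun n : ℕ => φ^[n.factorial] x) Filter.atTop (nhds (omegaPow φ x)) := by
  have hev : ∀ {c : FinIndexCon A} (g : A → c.1.Quotient) (y : FreeProfiniteSemigroup A),
      eval g (φ y) = eval (fun a => eval g (φ (of a))) y := by
    intro c g y
    have h := eval_lift g (fun a => φ (of a)) y
    rwa [← eq_lift_of_continuous φ hφ] at h
  have hit : ∀ (c : FinIndexCon A) (k : ℕ), (φ^[k] x).proj c =
      eval ((fun g : A → c.1.Quotient => fun a => eval g (φ (of a)))^[k]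
        fun a => (of a).proj c) x := by
    intro c k
    rw [proj_eq_eval]
    generalize (fun a => (of a).proj c) = g
    induction k generalizing g with
    | zero => rfl
    | succ k ih =>
      rw [Function.iterate_succ_apply', Function.iterate_succ_apply, ← ih]
      exact hev g _
  have hN : ∀ c : FinIndexCon A, ∃ N : ℕ, ∀ n ≥ N,
      (φ^[n.factorial] x).proj c = (φ^[N.factorial] x).proj c := by
    intro c
    obtain ⟨N, hN⟩ := eventually_iterate_factorial
      fun g : A → c.1.Quotient => fun a => eval g (φ (of a))
    refine ⟨N, fun n hn => ?_⟩
    rw [hit, hit, hN n hn]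
  choose N hN using hN
  let y : FreeProfiniteSemigroup A :=
    { proj := fun c => (φ^[(N c).factorial] x).proj c
      compat := by
        intro c d h w hw
        rw [← hN c (max (N c) (N d)) (le_max_left _ _)] at hw
        rw [← hN d (max (N c) (N d)) (le_max_right _ _)]
        exact (φ^[(max (N c) (N d)).factorial] x).compat c d h w hw }
  have hy : Filter.Tendsto (fun n : ℕ => φ^[n.factorial] x) Filter.atTop (nhds y) := by
    rw [tendsto_iff]
    intro c
    filter_upwards [Filter.eventually_ge_atTop (N c)] with n hn
    exact hN c n hn
  have : omegaPow φ x = y := hy.limUnder_eq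
  rw [this]
  exact hy

end FreeProfiniteSemigroup

open FreeProfiniteSemigroup in
/-- A finite semigroup `S` satisfies the pseudoidentity `p = q` if every continuous homomorphism
from the free profinite semigroup into `S`, that is, the extension of every map `ψ` from the set of
free generators into `S`, takes the same value at `p` and `q`. -/
def FiniteSemigroup.Satisfies (S : FiniteSemigroup.{v}) {A : Type u}
    (p q : FreeProfiniteSemigroup A) : Prop :=
  ∀ ψ : A → S.carrier, eval ψ p = eval ψ q

/-- The class of all finite semigroups that satisfy all the pseudoidentities in `E`. -/
def definedByPseudoidentities {A : Type u}
    (E : Set (FreeProfiniteSemigroup A × FreeProfiniteSemigroup A)) : Set FiniteSemigroup.{v} :=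
  {S | ∀ e ∈ E, S.Satisfies e.1 e.2}

/-! ### The classes `SMN°_t` -/

open FreeProfiniteSemigroup in
/-- The continuous endomorphism `φ_t` of the free profinite semigroup on
`{y_1,…,y_t,z_1,…,z_t}` with `φ_t(y_i) = λ_{t,i}(y_1,…,y_t; z_1,…,z_t)` and `φ_t(z_i) = z_i`. The
generator `y_i` is `of (Sum.inl i)`, and `z_i` is `of (Sum.inr i)`. -/
def malcevEndo (t : ℕ) :
    FreeProfiniteSemigroup (Fin t ⊕ Fin t) →ₙ* FreeProfiniteSemigroup (Fin t ⊕ Fin t) :=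
  lift (Sum.elim
    (malcevLambda (fun i => of (Sum.inl i)) t fun i => of (Sum.inr i))
    fun i => of (Sum.inr i))

open FreeProfiniteSemigroup in
/-- The class of finite semigroups defined by `φ_t^ω(y_1) = ⋯ = φ_t^ω(y_t)`. -/
def SMNCirc (t : ℕ) : Set FiniteSemigroup.{u} :=
  definedByPseudoidentities
    {e | ∃ i j : Fin t, e = (omegaPow (malcevEndo t) (of (Sum.inl i)),
      omegaPow (malcevEndo t) (of (Sum.inl j)))}

/-!
An application of `φ_t^ω` to a tuple of elements of a finite semigroup `S` amounts to computing the
`λ_{n,i}` for a sequence `z` with period `t` and for a large `n`. So `S` lies in `SMNCirc t` if and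
only if, for `t`-tuples `x` and `t`-periodic sequences `z` in `S`, the tuple of the `λ_{n,i}` is
constant for some `n` (`mem_SMNCirc_iff`). As a constant tuple stays constant, this holds if `S` is
strongly Mal'cev nilpotent. In the converse direction, the bound on `n` has to be uniform in the
length of the tuples, and the sequences `z` are arbitrary, with values in `S¹`.

Work in the finite monoid `S¹`. The element `λ_{n+1,i}` is a multiple of all the `λ_{n,j}`, so for
large `n` there is a long block of indices in which all of them lie in a single `J`-class
(`CollapsesPeriodically.exists_bound`). Let `x_i` be the elements at the start of the block. By
stability, `λ_{n,i}` is then in the `R`-class of `x_i` and in the `L`-class of `x_{i-n}`, and the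
condition that the block stays in the `J`-class says that all products `x_i z_n x_{i+n+1}` do; it
involves the Green classes of the `x_i` only.

* The pseudoidentities for `t = 2` show that multiplication by `z` pairs an `L`-class of the
  `J`-class with at most one `R`-class, and conversely (`CollapsesPeriodically.greenR`,
  `CollapsesPeriodically.greenL`). Therefore `z_0` and `z_1` determine the class of `x_{i+1}` from
  that of `x_i`, and the classes of the `x_i` have a period `m ≤ |S¹|` whatever the length of the
  tuple is (`CollapsesPeriodically.exists_period`). Now `x_0, …, x_{m-1}` and `z_0, …, z_{m-1}` are
  data to which the pseudoidentities for `t = m` apply, once an identity among the `z_n` is replaced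
  by a suitable power of another one. They give that all the `x_i` lie in one `H`-class
  (`CollapsesPeriodically.green_of_products`).

* In this case the `λ_{n,i}` can be computed in a maximal subgroup `G` of `S`. If `G` is nilpotent,
  they become equal after at most `|G|` steps, again whatever the length of the tuple is
  (`CollapsesPeriodically.cyclicLambda_const_of_green`, `cyclicLambda_const_of_isNilpotent`).

* The pseudoidentities for `t = 2` imply that `G` is nilpotent (`PairsCollapse.isNilpotent`). A
  minimal counterexample is not simple, by a count of the conjugates of its maximal subgroups
  (`exists_normal_of_forall_isNilpotent`), so it has a nontrivial elementary abelian normal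
  `p`-subgroup `A`. A suitable choice of the `z_n` shows that `(1 - T)(1 - T⁻¹)` is nilpotent on `A`
  for each `T` by which an element of `G` acts (`PairsCollapse.conj_locally_nilpotent`). Hence `G`
  acts on `A` as a `p`-group, which has a nontrivial fixed point, and the center is not trivial.
-/

/-! ### Cyclic products over integer-indexed families -/

section CyclicProducts

variable {M N : Type*} [Semigroup M] [Semigroup N]

/-- The product `a_i z a_{i+1} z ⋯ z a_{i+k}` for a family indexed by the integers. -/
def cyclicProd (a : ℤ → M) (z : M) (i : ℤ) : ℕ → M
  | 0 => a i
  | k + 1 => cyclicProd a z i k * z * a (i + (k + 1 : ℕ))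

/-- The elements `λ_{n,i}`, indexed by all integers `i`; the families of interest are periodic in
`i` with period `t`, and `z` is an infinite sequence of which the first `n` terms matter. -/
def cyclicLambda (t : ℕ) (x : ℤ → M) (z : ℕ → M) : ℕ → ℤ → M
  | 0 => x
  | n + 1 => fun i => cyclicProd (cyclicLambda t x z n) (z n) i (t - 1)

theorem map_cyclicProd (f : M →ₙ* N) (a : ℤ → M) (z : M) (i : ℤ) (k : ℕ) :
    f (cyclicProd a z i k) = cyclicProd (fun j => f (a j)) (f z) i k := by
  induction k with
  | zero => rfl
  | succ k ih => simp [cyclicProd, ih]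

theorem map_cyclicLambda (f : M →ₙ* N) (t : ℕ) (x : ℤ → M) (z : ℕ → M) (n : ℕ) (i : ℤ) :
    f (cyclicLambda t x z n i) = cyclicLambda t (fun j => f (x j)) (fun k => f (z k)) n i := by
  induction n generalizing i with
  | zero => rfl
  | succ n ih =>
    rw [cyclicLambda, map_cyclicProd]
    simp only [ih]
    rfl

theorem cyclicProd_shift (a b : ℤ → M) (z : M) (i j : ℤ) (h : ∀ k : ℕ, a (i + k) = b (j + k))
    (k : ℕ) : cyclicProd a z i k = cyclicProd b z j k := by
  induction k with
  | zero => simpa [cyclicProd] using h 0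
  | succ k ih => rw [cyclicProd, cyclicProd, ih, h]

theorem cyclicLambda_add (t : ℕ) (x : ℤ → M) (z : ℕ → M) (n m : ℕ) :
    cyclicLambda t x z (n + m)
      = cyclicLambda t (cyclicLambda t x z n) (fun k => z (n + k)) m := by
  induction m with
  | zero => rfl
  | succ m ih =>
    funext i
    change cyclicProd (cyclicLambda t x z (n + m)) _ i _ = cyclicProd _ _ i _
    rw [ih]
    rfl

theorem cyclicLambda_periodic {t : ℕ} {x : ℤ → M} (hx : ∀ i, x (i + t) = x i) (z : ℕ → M)
    (n : ℕ) (i : ℤ) : cyclicLambda t x z n (i + t) = cyclicLambda t x z n i := by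
  induction n generalizing i with
  | zero => exact hx i
  | succ n ih =>
    refine cyclicProd_shift _ _ _ _ _ (fun k => ?_) _
    rw [← ih (i + k)]
    congr 1
    ring

theorem cyclicLambda_const_of_le {t : ℕ} {x : ℤ → M} {z : ℕ → M} {n m : ℕ} (hnm : n ≤ m)
    (h : ∀ i j, cyclicLambda t x z n i = cyclicLambda t x z n j) (i j : ℤ) :
    cyclicLambda t x z m i = cyclicLambda t x z m j := by
  induction m, hnm using Nat.le_induction generalizing i j with
  | base => exact h i j
  | succ m _ ih => exact cyclicProd_shift _ _ _ _ _ (fun k => ih _ _) _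

theorem eq_of_int_modEq {α : Type*} {x : ℤ → α} {t : ℤ} (hx : ∀ i, x (i + t) = x i) {i j : ℤ}
    (h : t ∣ j - i) : x i = x j := by
  obtain ⟨k, hk⟩ := h
  have key := (show Function.Periodic x t from hx).int_mul k i
  rw [← key]
  congr 1
  simp only [Int.cast_id]
  linear_combination -hk

/-- A family indexed by `Fin t`, continued periodically to the integers. -/
def periodicExt {α : Type*} {t : ℕ} (ht : 0 < t) (x : Fin t → α) (i : ℤ) : α :=
  x ⟨(i % t).toNat, by have := Int.emod_lt_of_pos i (Int.ofNat_lt.mpr ht)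
                       have := Int.emod_nonneg i (show (t : ℤ) ≠ 0 by omega); omega⟩

theorem periodicExt_periodic {α : Type*} {t : ℕ} (ht : 0 < t) (x : Fin t → α) (i : ℤ) :
    periodicExt ht x (i + t) = periodicExt ht x i := by
  simp [periodicExt]

theorem periodicExt_coe {α : Type*} {t : ℕ} (ht : 0 < t) (x : Fin t → α) (i : Fin t) :
    periodicExt ht x ((i : ℕ) : ℤ) = x i := by
  simp only [periodicExt]
  congr 1
  ext
  simp only
  rw [← Int.natCast_mod, Int.toNat_natCast, Nat.mod_eq_of_lt i.2]

theorem interleave_eq_cyclicProd {t : ℕ} (ht : 0 < t) (a : Fin t → M) (z : M) (i : Fin t)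
    (k : ℕ) : interleave a z i k = cyclicProd (periodicExt ht a) z ((i : ℕ) : ℤ) k := by
  induction k with
  | zero => exact (periodicExt_coe ht a i).symm
  | succ k ih =>
    rw [interleave, cyclicProd, ih]
    congr 1

theorem periodicExt_malcevLambda {t : ℕ} (ht : 0 < t) (x : Fin t → M) (z : ℕ → M) (n : ℕ)
    (i : ℤ) : periodicExt ht (malcevLambda x n fun k => z k) i
      = cyclicLambda t (periodicExt ht x) z n i := by
  induction n generalizing i with
  | zero => rfl
  | succ n ih =>
    have hi : (((i % t).toNat : ℕ) : ℤ) = i % t :=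
      Int.toNat_of_nonneg (Int.emod_nonneg i (by omega))
    rw [periodicExt, malcevLambda, interleave_eq_cyclicProd ht, cyclicLambda]
    refine cyclicProd_shift _ _ _ _ _ (fun k => ?_) _
    refine (ih _).trans (eq_of_int_modEq (cyclicLambda_periodic (periodicExt_periodic ht x) z n) ?_)
    simp only [hi]
    have := Int.dvd_sub_self_of_emod_eq (a := i) (b := (t : ℤ)) rfl
    simpa using dvd_sub_comm.mp this

theorem malcevLambda_eq_cyclicLambda {t : ℕ} (ht : 0 < t) (x : Fin t → M) (z : ℕ → M) (n : ℕ)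
    (i : Fin t) : malcevLambda x n (fun k => z k) i
      = cyclicLambda t (periodicExt ht x) z n ((i : ℕ) : ℤ) := by
  rw [← periodicExt_malcevLambda ht, periodicExt_coe]

end CyclicProducts

/-! ### Green's relations in a finite monoid -/

section Green

variable {M : Type*} [Monoid M]

/-- The elements `a` and `b` generate the same right ideal. -/
def GreenR (a b : M) : Prop := (∃ u, a = b * u) ∧ ∃ u, b = a * u

/-- The elements `a` and `b` generate the same left ideal. -/
def GreenL (a b : M) : Prop := (∃ u, a = u * b) ∧ ∃ u, b = u * a

/-- The elements `a` and `b` generate the same two-sided ideal. -/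
def GreenJ (a b : M) : Prop := (∃ u v, a = u * b * v) ∧ ∃ u v, b = u * a * v

variable {a b c a' b' z : M}

theorem GreenR.refl (a : M) : GreenR a a := ⟨⟨1, by simp⟩, 1, by simp⟩

theorem GreenL.refl (a : M) : GreenL a a := ⟨⟨1, by simp⟩, 1, by simp⟩

theorem GreenJ.refl (a : M) : GreenJ a a := ⟨⟨1, 1, by simp⟩, 1, 1, by simp⟩

theorem GreenR.symm (h : GreenR a b) : GreenR b a := ⟨h.2, h.1⟩

theorem GreenL.symm (h : GreenL a b) : GreenL b a := ⟨h.2, h.1⟩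

theorem GreenJ.symm (h : GreenJ a b) : GreenJ b a := ⟨h.2, h.1⟩

theorem GreenR.trans (h : GreenR a b) (h' : GreenR b c) : GreenR a c := by
  obtain ⟨⟨u, rfl⟩, v, hv⟩ := h
  obtain ⟨⟨u', rfl⟩, v', hv'⟩ := h'
  exact ⟨⟨u' * u, by simp [mul_assoc]⟩, v * v', by rw [← mul_assoc, ← hv, ← hv']⟩

theorem GreenL.trans (h : GreenL a b) (h' : GreenL b c) : GreenL a c := by
  obtain ⟨⟨u, rfl⟩, v, hv⟩ := h
  obtain ⟨⟨u', rfl⟩, v', hv'⟩ := h'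
  exact ⟨⟨u * u', by simp [mul_assoc]⟩, v' * v, by rw [mul_assoc v', ← hv, ← hv']⟩

theorem GreenJ.trans (h : GreenJ a b) (h' : GreenJ b c) : GreenJ a c := by
  obtain ⟨⟨u, v, hu⟩, p, q, hp⟩ := h
  obtain ⟨⟨u', v', hu'⟩, p', q', hp'⟩ := h'
  refine ⟨⟨u * u', v' * v, ?_⟩, p' * p, q * q', ?_⟩
  · rw [hu, hu']; simp only [mul_assoc]
  · rw [hp', hp]; simp only [mul_assoc]

theorem GreenR.greenJ (h : GreenR a b) : GreenJ a b := by
  obtain ⟨⟨u, hu⟩, v, hv⟩ := h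
  exact ⟨⟨1, u, by simpa using hu⟩, 1, v, by simpa using hv⟩

theorem GreenL.greenJ (h : GreenL a b) : GreenJ a b := by
  obtain ⟨⟨u, hu⟩, v, hv⟩ := h
  exact ⟨⟨u, 1, by simpa using hu⟩, v, 1, by simpa using hv⟩

theorem GreenR.mul_left (c : M) (h : GreenR a b) : GreenR (c * a) (c * b) := by
  obtain ⟨⟨u, hu⟩, v, hv⟩ := h
  exact ⟨⟨u, by rw [mul_assoc, ← hu]⟩, v, by rw [mul_assoc, ← hv]⟩

theorem GreenL.mul_right (c : M) (h : GreenL a b) : GreenL (a * c) (b * c) := by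
  obtain ⟨⟨u, hu⟩, v, hv⟩ := h
  exact ⟨⟨u, by rw [← mul_assoc, ← hu]⟩, v, by rw [← mul_assoc, ← hv]⟩

/-- Whether a product `a z b` stays in a given `J`-class depends only on the `L`-class of `a` and
the `R`-class of `b`. -/
theorem greenJ_mul_congr (ha : GreenL a a') (hb : GreenR b b') (h : GreenJ (a * z * b) c) :
    GreenJ (a' * z * b') c := by
  have h1 := (ha.mul_right (z * b)).greenJ
  have h2 := (hb.mul_left (a' * z)).greenJ
  simp only [← mul_assoc] at h1
  exact (h2.symm.trans h1.symm).trans h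

/-- A product that stays in the `J`-class of `a` does so after any initial part that begins
with `a`. -/
theorem greenJ_of_mul (h : GreenJ (a * b * c) a) : GreenJ (a * b) a := by
  obtain ⟨_, u, v, h⟩ := h
  exact ⟨⟨1, b, by simp⟩, u, c * v, h.trans (by simp only [mul_assoc])⟩

theorem exists_pow_eq_pow [Finite M] (a : M) : ∃ i k : ℕ, a ^ (i + (k + 1)) = a ^ i := by
  obtain ⟨i, j, hij, h⟩ := Finite.exists_ne_map_eq_of_infinite fun n : ℕ => a ^ n
  rcases lt_or_gt_of_ne hij with h' | h'
  · exact ⟨i, j - i - 1, by rw [h]; congr 1; omega⟩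
  · exact ⟨j, i - j - 1, by rw [← h]; congr 1; omega⟩

/-- If `u a w = a` in a finite monoid, then `w` acts on `a` as an element of a group. -/
theorem exists_mul_pow_eq_self [Finite M] {u w : M} (h : u * a * w = a) :
    ∃ k : ℕ, a * w ^ (k + 1) = a := by
  have key : ∀ k : ℕ, u ^ k * a * w ^ k = a := by
    intro k
    induction k with
    | zero => simp
    | succ k ih =>
      calc u ^ (k + 1) * a * w ^ (k + 1) = u ^ k * (u * a * w) * w ^ k := by
            rw [pow_succ, pow_succ']; simp only [mul_assoc]
        _ = a := by rw [h, ih]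
  obtain ⟨i, k, hik⟩ := exists_pow_eq_pow w
  refine ⟨k, ?_⟩
  calc a * w ^ (k + 1) = u ^ i * a * w ^ i * w ^ (k + 1) := by rw [key]
    _ = u ^ i * a * w ^ (i + (k + 1)) := by rw [pow_add w i, mul_assoc _ (w ^ i)]
    _ = a := by rw [hik, key]

theorem exists_pow_mul_eq_self [Finite M] {u w : M} (h : u * a * w = a) :
    ∃ k : ℕ, u ^ (k + 1) * a = a := by
  have : Finite Mᵐᵒᵖ := Finite.of_equiv M MulOpposite.opEquiv
  obtain ⟨k, hk⟩ := exists_mul_pow_eq_self (M := Mᵐᵒᵖ) (a := MulOpposite.op a)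
    (u := MulOpposite.op w) (w := MulOpposite.op u)
    (MulOpposite.unop_injective (by simpa [mul_assoc] using h))
  exact ⟨k, by simpa using congrArg MulOpposite.unop hk⟩

variable [Finite M]

/-- Stability of finite monoids, on the right. -/
theorem GreenJ.greenR_mul (h : GreenJ (a * b) a) : GreenR (a * b) a := by
  refine ⟨⟨b, rfl⟩, ?_⟩
  obtain ⟨_, u, v, h⟩ := h
  obtain ⟨k, hk⟩ := exists_mul_pow_eq_self (a := a) (u := u) (w := b * v)
    (by simp only [mul_assoc] at h ⊢; exact h.symm)
  refine ⟨v * (b * v) ^ k, ?_⟩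
  rw [pow_succ'] at hk
  simpa only [mul_assoc] using hk.symm

/-- Stability of finite monoids, on the left. -/
theorem GreenJ.greenL_mul (h : GreenJ (b * a) a) : GreenL (b * a) a := by
  refine ⟨⟨b, rfl⟩, ?_⟩
  obtain ⟨_, u, v, h⟩ := h
  obtain ⟨k, hk⟩ := exists_pow_mul_eq_self (a := a) (u := u * b) (w := v)
    (by simp only [mul_assoc] at h ⊢; exact h.symm)
  refine ⟨(u * b) ^ k * u, ?_⟩
  rw [pow_succ] at hk
  simpa only [mul_assoc] using hk.symm

/-- In a finite monoid the `R`-class of `b` meets the `L`-class of `a` if `a` and `b` are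
`J`-equivalent. -/
theorem GreenJ.exists_greenR_greenL (h : GreenJ a b) :
    ∃ p : M, GreenR (p * a) b ∧ GreenL (p * a) a := by
  obtain ⟨⟨u, v, hu⟩, p, q, hp⟩ := h
  have h1 : GreenJ (p * a) a :=
    ⟨⟨p, 1, by simp⟩, u, q * v, by
      calc a = u * (p * a * q) * v := by rw [← hp]; exact hu
        _ = _ := by simp only [mul_assoc]⟩
  refine ⟨p, ?_, h1.greenL_mul⟩
  have h2 : GreenJ (p * a * q) (p * a) := by
    rw [← hp]
    exact (h1.trans ⟨⟨u, v, hu⟩, p, q, hp⟩).symm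
  rw [hp]
  exact h2.greenR_mul.symm

/-- In a finite monoid the `L`-class of `b` meets the `R`-class of `a` if `a` and `b` are
`J`-equivalent. -/
theorem GreenJ.exists_greenL_greenR (h : GreenJ a b) :
    ∃ p : M, GreenL (a * p) b ∧ GreenR (a * p) a := by
  obtain ⟨⟨u, v, hu⟩, p, q, hp⟩ := h
  have h1 : GreenJ (a * q) a :=
    ⟨⟨1, q, by simp⟩, u * p, v, by
      calc a = u * (p * a * q) * v := by rw [← hp]; exact hu
        _ = _ := by simp only [mul_assoc]⟩
  refine ⟨q, ?_, h1.greenR_mul⟩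
  have h2 : GreenJ (p * (a * q)) (a * q) := by
    rw [← mul_assoc, ← hp]
    exact (h1.trans ⟨⟨u, v, hu⟩, p, q, hp⟩).symm
  rw [hp, mul_assoc]
  exact h2.greenL_mul.symm

end Green

/-! ### The Green classes of the elements `λ_{n,i}` -/

section Collapse

variable {M : Type*} [Monoid M]

/-- For every `m ≥ 2`, every `m`-periodic family `x` and every `m`-periodic sequence `z` with values
in `I`, the family `λ_{n,i}` becomes constant for some `n`. In the application `M` is `S¹`, and `I`
is the ideal `S`; the lemmas below use that `I` is an ideal (`hI`) and that it contains every element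
except possibly the identity (`hI1`). -/
def CollapsesPeriodically (I : Set M) : Prop :=
  ∀ m : ℕ, 2 ≤ m → ∀ (x : ℤ → M) (z : ℕ → M), (∀ i, x i ∈ I) → (∀ n, z n ∈ I) →
    (∀ i, x (i + m) = x i) → (∀ n, z (n + m) = z n) →
    ∃ n, ∀ i j, cyclicLambda m x z n i = cyclicLambda m x z n j

variable [Finite M] {I : Set M} {c : M} {t : ℕ} {x : ℤ → M} {z : ℕ → M}

/-- If all the products `x_i z_n x_{i+n+1}` lie in a single `J`-class, then so do the `λ_{n,i}`, the
`R`-class of `λ_{n,i}` does not depend on `n`, and its `L`-class rotates. -/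
theorem green_cyclicLambda (ht : 0 < t) (hx : ∀ i, x (i + t) = x i)
    (hc : ∀ i, GreenJ (x i) c) (hz : ∀ (n : ℕ) (i : ℤ), GreenJ (x i * z n * x (i + n + 1)) c)
    (n : ℕ) (i : ℤ) :
    GreenR (cyclicLambda t x z n i) (x i) ∧ GreenL (cyclicLambda t x z n i) (x (i - n)) := by
  induction n generalizing i with
  | zero => exact ⟨GreenR.refl _, by simpa [cyclicLambda] using GreenL.refl (x i)⟩
  | succ n ih =>
    have key : ∀ k : ℕ, GreenR (cyclicProd (cyclicLambda t x z n) (z n) i k) (x i) ∧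
        GreenL (cyclicProd (cyclicLambda t x z n) (z n) i k) (x (i + k - n)) := by
      intro k
      induction k with
      | zero => simpa [cyclicProd] using ih i
      | succ k ihk =>
        have hJ : GreenJ (cyclicProd (cyclicLambda t x z n) (z n) i (k + 1)) c := by
          refine greenJ_mul_congr ihk.2.symm (ih _).1.symm ?_
          have := hz n (i + k - n)
          rwa [show i + k - n + n + 1 = i + (k + 1 : ℕ) by push_cast; ring] at this
        constructor
        · have h1 := ihk.1.greenJ.trans (hc i)
          rw [cyclicProd, mul_assoc] at hJ ⊢
          exact (hJ.trans h1.symm).greenR_mul.trans ihk.1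
        · have h1 := (ih (i + (k + 1 : ℕ))).1.greenJ.trans (hc _)
          exact (hJ.trans h1.symm).greenL_mul.trans (ih _).2
    refine ⟨(key (t - 1)).1, ?_⟩
    have h2 := (key (t - 1)).2
    rwa [show x (i + (t - 1 : ℕ) - n) = x (i - (n + 1 : ℕ)) from
      (eq_of_int_modEq hx ⟨1, by push_cast [ht]; omega⟩).symm] at h2

/-- Under `CollapsesPeriodically`, the configurations of `green_cyclicLambda` are degenerate. -/
theorem CollapsesPeriodically.green (hC : CollapsesPeriodically I) (ht : 2 ≤ t)
    (hx : ∀ i, x (i + t) = x i) (hz : ∀ n, z (n + t) = z n) (hxI : ∀ i, x i ∈ I)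
    (hzI : ∀ n, z n ∈ I) (hc : ∀ i, GreenJ (x i) c)
    (hxz : ∀ (n : ℕ) (i : ℤ), GreenJ (x i * z n * x (i + n + 1)) c) (i j : ℤ) :
    GreenR (x i) (x j) ∧ GreenL (x i) (x j) := by
  obtain ⟨n, hn⟩ := hC t ht x z hxI hzI hx hz
  have key := green_cyclicLambda (by omega) hx hc hxz n
  constructor
  · have h1 := (key i).1
    rw [hn i j] at h1
    exact h1.symm.trans (key j).1
  · have h1 := (key (i + n)).2
    rw [hn (i + n) (j + n)] at h1
    have h2 := h1.symm.trans (key (j + n)).2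
    simpa using h2

/-- In each `J`-class, multiplication by `z` pairs an `L`-class with at most one `R`-class: if it
paired the class of `a` with two of them, elements `x_1, x_2` in their intersections with the
`L`-class of `a` would not collapse for `t = 2`. -/
theorem CollapsesPeriodically.greenR (hC : CollapsesPeriodically I)
    (hI : ∀ a ∈ I, ∀ u, u * a ∈ I ∧ a * u ∈ I) {a b b' w : M} (haI : a ∈ I)
    (ha : GreenJ a c) (hb : GreenJ b c) (hb' : GreenJ b' c)
    (h : GreenJ (a * w * b) c) (h' : GreenJ (a * w * b') c) : GreenR b b' := by
  obtain ⟨p, hp, hpa⟩ := (ha.trans hb.symm).exists_greenR_greenL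
  obtain ⟨p', hp', hpa'⟩ := (ha.trans hb'.symm).exists_greenR_greenL
  have h1 : GreenR (a * w * b) a := by
    rw [mul_assoc] at h ⊢
    exact (h.trans ha.symm).greenR_mul
  obtain ⟨v, hv⟩ := h1.2
  -- `w₀` pairs the `L`-class of `a` as `w` does, and lies in `I`.
  let w₀ := w * b * v * w
  have hw₀ : a * w₀ = a * w := by
    calc a * w₀ = a * w * b * v * w := by simp only [w₀, mul_assoc]
      _ = a * w := by rw [← hv]
  have hbI : b ∈ I := by
    obtain ⟨u, u', rfl⟩ := (hb.trans ha.symm).1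
    exact (hI _ (hI a haI u).1 u').2
  have hw₀I : w₀ ∈ I := (hI _ (hI _ (hI b hbI w).1 v).2 w).2
  let y : ℤ → M := fun i => if Even i then p * a else p' * a
  have hyL : ∀ i, GreenL (y i) a := by
    intro i
    by_cases hi : Even i <;> simp [y, hi, hpa, hpa']
  have hyR : ∀ i, GreenJ (a * w₀ * y i) c := by
    intro i
    rw [hw₀]
    by_cases hi : Even i
    · simpa only [y, hi, if_true] using greenJ_mul_congr (GreenL.refl a) hp.symm h
    · simpa only [y, hi, if_false] using greenJ_mul_congr (GreenL.refl a) hp'.symm h'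
  have key := hC.green (t := 2) (x := y) (z := fun _ => w₀) (c := c) le_rfl
    (fun i => by simp [y]) (fun _ => rfl)
    (fun i => by
      by_cases hi : Even i
      · simpa only [y, hi, if_true] using (hI a haI p).1
      · simpa only [y, hi, if_false] using (hI a haI p').1)
    (fun _ => hw₀I) (fun i => (hyL i).greenJ.trans ha)
    (fun n i => greenJ_mul_congr (hyL i).symm (GreenR.refl _) (hyR _)) 0 1
  have h01 : GreenR (p * a) (p' * a) := by simpa [y] using key.1
  exact (hp.symm.trans h01).trans hp'

/-- The left-right dual of `CollapsesPeriodically.greenR`. -/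
theorem CollapsesPeriodically.greenL (hC : CollapsesPeriodically I)
    (hI : ∀ a ∈ I, ∀ u, u * a ∈ I ∧ a * u ∈ I) {a a' b w : M} (hbI : b ∈ I)
    (ha : GreenJ a c) (ha' : GreenJ a' c) (hb : GreenJ b c)
    (h : GreenJ (a * w * b) c) (h' : GreenJ (a' * w * b) c) : GreenL a a' := by
  obtain ⟨p, hp, hpa⟩ := (hb.trans ha.symm).exists_greenL_greenR
  obtain ⟨p', hp', hpa'⟩ := (hb.trans ha'.symm).exists_greenL_greenR
  obtain ⟨v, hv⟩ := (h.trans hb.symm).greenL_mul.2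
  let w₀ := w * v * a * w
  have hw₀ : w₀ * b = w * b := by
    calc w₀ * b = w * (v * (a * w * b)) := by simp only [w₀, mul_assoc]
      _ = w * b := by rw [← hv]
  have haI : a ∈ I := by
    obtain ⟨u, u', rfl⟩ := (ha.trans hb.symm).1
    exact (hI _ (hI b hbI u).1 u').2
  have hw₀I : w₀ ∈ I := (hI _ (hI a haI (w * v)).1 w).2
  let y : ℤ → M := fun i => if Even i then b * p else b * p'
  have hyR : ∀ i, GreenR (y i) b := by
    intro i
    by_cases hi : Even i <;> simp [y, hi, hpa, hpa']
  have hyL : ∀ i, GreenJ (y i * w₀ * b) c := by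
    intro i
    rw [mul_assoc, hw₀, ← mul_assoc]
    by_cases hi : Even i
    · simpa only [y, hi, if_true] using greenJ_mul_congr hp.symm (GreenR.refl b) h
    · simpa only [y, hi, if_false] using greenJ_mul_congr hp'.symm (GreenR.refl b) h'
  have key := hC.green (t := 2) (x := y) (z := fun _ => w₀) (c := c) le_rfl
    (fun i => by simp [y]) (fun _ => rfl)
    (fun i => by
      by_cases hi : Even i
      · simpa only [y, hi, if_true] using (hI b hbI p).2
      · simpa only [y, hi, if_false] using (hI b hbI p').2)
    (fun _ => hw₀I) (fun i => (hyR i).greenJ.trans hb)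
    (fun n i => greenJ_mul_congr (GreenL.refl _) (hyR _).symm (hyL _)) 0 1
  have h01 : GreenL (b * p) (b * p') := by simpa [y] using key.2
  exact (hp.symm.trans h01).trans hp'

theorem rel_of_rel_succ {α : Type*} {r : α → α → Prop} (hrefl : ∀ a, r a a)
    (hsymm : ∀ {a b}, r a b → r b a) (htrans : ∀ {a b c}, r a b → r b c → r a c) {f : ℤ → α}
    {m : ℤ} (h : ∀ i, r (f (i + m)) (f i)) (k i : ℤ) : r (f (i + m * k)) (f i) := by
  induction k with
  | zero => simpa using hrefl _
  | succ k ih =>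
    refine htrans ?_ ih
    have := h (i + m * k)
    rwa [show i + m * k + m = i + m * (k + 1) by ring] at this
  | pred k ih =>
    refine htrans (hsymm ?_) ih
    have := h (i + m * (-k - 1))
    rwa [show i + m * (-(k : ℤ) - 1) + m = i + m * -k by ring] at this

/-- The Green classes of the `x_i` are periodic in `i`, with a period that does not depend on the
length `t` of the family: `z 0` and `z 1` determine the class of `x_{i+1}` from that of `x_i`. -/
theorem CollapsesPeriodically.exists_period (hC : CollapsesPeriodically I)
    (hI : ∀ a ∈ I, ∀ u, u * a ∈ I ∧ a * u ∈ I) (ht : 0 < t)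
    (hx : ∀ i, x (i + t) = x i) (hxI : ∀ i, x i ∈ I) (hc : ∀ i, GreenJ (x i) c)
    (hxz : ∀ n : ℕ, n < 2 → ∀ i : ℤ, GreenJ (x i * z n * x (i + n + 1)) c) :
    ∃ m : ℕ, 1 ≤ m ∧ m ≤ Nat.card M ∧ ∀ i, GreenR (x (i + m)) (x i) ∧ GreenL (x (i + m)) (x i) := by
  have hL : ∀ i j, GreenR (x (i + 1)) (x (j + 1)) → GreenL (x i) (x j) := by
    intro i j hij
    have hi := hxz 0 (by omega) i
    have hj := hxz 0 (by omega) j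
    simp only [Nat.cast_zero, add_zero] at hi hj
    exact hC.greenL hI (hxI _) (hc _) (hc _) (hc (j + 1))
      (greenJ_mul_congr (GreenL.refl _) hij hi) hj
  have hR : ∀ i j, GreenR (x i) (x j) → GreenR (x (i + 1)) (x (j + 1)) := by
    intro i j hij
    have hij' := hL (i - 1) (j - 1) (by simpa using hij)
    have hi := hxz 1 (by omega) (i - 1)
    have hj := hxz 1 (by omega) (j - 1)
    rw [show i - 1 + (1 : ℕ) + 1 = i + 1 by push_cast; ring] at hi
    rw [show j - 1 + (1 : ℕ) + 1 = j + 1 by push_cast; ring] at hj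
    exact hC.greenR hI (hxI _) (hc (j - 1)) (hc _) (hc _)
      (greenJ_mul_congr hij' (GreenR.refl _) hi) hj
  obtain ⟨a, b, hab, hlt⟩ : ∃ a b : ℕ, x a = x b ∧ a < b ∧ b ≤ Nat.card M := by
    have : ¬ Function.Injective fun k : Fin (Nat.card M + 1) => x (k : ℕ) := by
      intro hinj
      have := Nat.card_le_card_of_injective _ hinj
      simp at this
    simp only [Function.Injective, not_forall] at this
    obtain ⟨k, l, hkl, hne⟩ := this
    have hk := k.2
    have hl := l.2
    have hne' : (k : ℕ) ≠ l := fun h => hne (Fin.ext h)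
    rcases lt_or_gt_of_ne hne' with h | h
    · exact ⟨k, l, hkl, h, by omega⟩
    · exact ⟨l, k, hkl.symm, h, by omega⟩
  have hs : ∀ s : ℕ, GreenR (x (a + s)) (x (b + s)) := by
    intro s
    induction s with
    | zero => simpa [hab] using GreenR.refl _
    | succ s ih => simpa [add_assoc] using hR _ _ ih
  have hper : ∀ i, GreenR (x (i + (b - a : ℕ))) (x i) := by
    intro i
    have h1 := hs ((i - a) % t).toNat
    have h2 : (((i - a) % t).toNat : ℤ) = (i - a) % t :=
      Int.toNat_of_nonneg (Int.emod_nonneg _ (by omega))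
    have h3 := Int.mul_ediv_add_emod (i - a) t
    rw [eq_of_int_modEq hx (i := a + ((i - a) % t).toNat) (j := i)
        ⟨(i - a) / t, by rw [h2]; linarith⟩,
      eq_of_int_modEq hx (i := b + ((i - a) % t).toNat) (j := i + (b - a : ℕ))
        ⟨(i - a) / t, by rw [h2]; push_cast [hlt.1.le]; linarith⟩] at h1
    exact h1.symm
  refine ⟨b - a, by omega, by omega, fun i => ⟨hper i, hL _ _ ?_⟩⟩
  have := hper (i + 1)
  rwa [show i + 1 + ((b - a : ℕ) : ℤ) = i + (b - a : ℕ) + 1 by ring] at this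

/-- If the products `x_i z_n x_{i+n+1}` lie in a single `J`-class for sufficiently many `n`, then the
`x_i` lie in a single `H`-class: one period of the `x_i` and the `z_n` is a degenerate configuration
by `CollapsesPeriodically.green`. -/
theorem CollapsesPeriodically.green_of_products (hC : CollapsesPeriodically I)
    (hI : ∀ a ∈ I, ∀ u, u * a ∈ I ∧ a * u ∈ I) (hI1 : ∀ a, a ∉ I → a = 1) (ht : 0 < t)
    (hx : ∀ i, x (i + t) = x i) (hxI : ∀ i, x i ∈ I) (hc : ∀ i, GreenJ (x i) c)
    (hxz : ∀ n : ℕ, n < Nat.card M + 2 → ∀ i : ℤ, GreenJ (x i * z n * x (i + n + 1)) c)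
    (i j : ℤ) : GreenR (x i) (x j) ∧ GreenL (x i) (x j) := by
  have of_succ : (∀ k, GreenR (x (k + 1)) (x k) ∧ GreenL (x (k + 1)) (x k)) →
      GreenR (x i) (x j) ∧ GreenL (x i) (x j) := by
    intro h
    have h1 := rel_of_rel_succ GreenR.refl GreenR.symm GreenR.trans (fun k => (h k).1) (i - j) j
    have h2 := rel_of_rel_succ GreenL.refl GreenL.symm GreenL.trans (fun k => (h k).2) (i - j) j
    simp only [one_mul, add_sub_cancel] at h1 h2
    exact ⟨h1, h2⟩
  obtain ⟨m, hm1, hm, hper⟩ := hC.exists_period hI ht hx hxI hc fun n hn => hxz n (by omega)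
  have hperR := rel_of_rel_succ GreenR.refl GreenR.symm GreenR.trans fun k => (hper k).1
  have hperL := rel_of_rel_succ GreenL.refl GreenL.symm GreenL.trans fun k => (hper k).2
  rcases hm1.eq_or_lt with rfl | hm2
  · exact of_succ (by simpa using hper)
  by_cases hall : ∀ n < m, z n ∉ I
  · -- If `z 0 = z 1 = 1`, the classes of the `x_i` do not depend on `i`.
    have h0 := hI1 _ (hall 0 (by omega))
    have h1 := hI1 _ (hall 1 (by omega))
    have hx0 := hxz 0 (by omega)
    have hx1 := hxz 1 (by omega)
    simp only [h0, h1, Nat.cast_zero, add_zero, Nat.cast_one] at hx0 hx1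
    refine of_succ fun k => ⟨?_, ?_⟩
    · refine hC.greenR hI (hxI (k - 1)) (hc _) (hc _) (hc _) (w := 1) ?_ ?_
      · have := hx1 (k - 1)
        rwa [show k - 1 + 1 + 1 = k + 1 by ring] at this
      · have := hx0 (k - 1)
        rwa [show k - 1 + 1 = k by ring] at this
    · exact hC.greenL hI (hxI (k + 1 + 1)) (hc _) (hc _) (hc _) (w := 1) (hx0 _) (hx1 _)
  push Not at hall
  obtain ⟨e, he, heI⟩ := hall
  -- The `m`-th power of `z e` pairs the classes of the `x_i` as an identity among the `z n` does.
  have repl : ∀ n < m, ∃ w ∈ I, ∀ k : ℤ, GreenJ (x k * w * x (k + n + 1)) c := by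
    intro n hn
    by_cases hnI : z n ∈ I
    · exact ⟨z n, hnI, hxz n (by omega)⟩
    have hn1 := hxz n (by omega)
    rw [hI1 _ hnI] at hn1
    have key : ∀ (s : ℕ) (k : ℤ),
        GreenJ (x k * z e ^ s * x (k + n + 1 + (e - n) * s)) c := by
      intro s k
      induction s with
      | zero => simpa using hn1 k
      | succ s ih =>
        have ha : GreenJ (x k * z e ^ s) c :=
          (greenJ_of_mul (ih.trans (hc k).symm)).trans (hc k)
        have h1 := hn1 (k + (e - n) * s)
        rw [show k + (e - n) * s + n + 1 = k + n + 1 + (e - n) * s by ring] at h1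
        have h2 := hC.greenL hI (hxI _) ha (hc (k + (e - n) * s)) (hc _) (w := 1)
          (by simpa using ih) h1
        have h3 := greenJ_mul_congr h2.symm (GreenR.refl _) (hxz e (by omega) (k + (e - n) * s))
        rw [pow_succ, ← mul_assoc]
        convert h3 using 3
        push_cast
        ring
    refine ⟨z e ^ m, ?_, fun k => ?_⟩
    · obtain ⟨m', rfl⟩ : ∃ m', m = m' + 1 := ⟨m - 1, by omega⟩
      rw [pow_succ]
      exact (hI _ heI _).1
    · refine greenJ_mul_congr (GreenL.refl _) ?_ (key m k)
      rw [mul_comm]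
      exact hperR _ _
  choose! w hwI hw using repl
  let y : ℤ → M := fun k => x (k % m)
  have hemod : ∀ k : ℤ, k % m = k + m * (-(k / m)) := by
    intro k
    have := Int.mul_ediv_add_emod k m
    linarith
  have hyR : ∀ k, GreenR (y k) (x k) := by
    intro k
    simp only [y]
    rw [hemod]
    exact hperR _ _
  have hyL : ∀ k, GreenL (y k) (x k) := by
    intro k
    simp only [y]
    rw [hemod]
    exact hperL _ _
  have hmod : ∀ n : ℕ, n % m < m := fun n => Nat.mod_lt _ (by omega)
  have key := hC.green (t := m) (x := y) (z := fun n => w (n % m)) (c := c) hm2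
    (fun k => by simp [y]) (fun n => by simp) (fun k => hxI _) (fun n => hwI _ (hmod n))
    (fun k => hc _) (fun n k => by
      refine greenJ_mul_congr (hyL k).symm ?_ (hw (n % m) (hmod n) k)
      refine GreenR.trans ?_ (hyR _).symm
      have h1 := (hperR (n / m : ℕ) (k + (n % m : ℕ) + 1)).symm
      rwa [show k + ((n % m : ℕ) : ℤ) + 1 + m * (n / m : ℕ) = k + n + 1 by
        have := Nat.div_add_mod n m
        zify at this ⊢
        linarith] at h1) i j
  exact ⟨((hyR i).symm.trans key.1).trans (hyR j), ((hyL i).symm.trans key.2).trans (hyL j)⟩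

end Collapse

/-! ### Finite groups in which pairs collapse are nilpotent -/

section Simple

variable {G : Type*} [Group G]

open Subgroup

theorem isCoatom_map_conj {H : Subgroup G} (hH : IsCoatom H) (g : G) :
    IsCoatom (H.map (MulAut.conj g).toMonoidHom) :=
  ((MulAut.conj g).mapSubgroup.isCoatom_iff H).mpr hH

theorem mem_normalizer_of_map_conj_eq {H : Subgroup G} {g : G}
    (h : H.map (MulAut.conj g).toMonoidHom = H) : g ∈ normalizer H := by
  rw [mem_normalizer_iff]
  intro k
  constructor
  · intro hk
    rw [← h]
    exact ⟨k, hk, by simp⟩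
  · intro hk
    rw [← h] at hk
    obtain ⟨l, hl, hlk⟩ := hk
    have : l = k := by simpa using hlk
    exact this ▸ hl

/-- If the proper subgroups of a finite group are nilpotent and it has no proper nontrivial normal
subgroup, then two different maximal subgroups intersect trivially: the normalizer of a maximal
intersection `D` meets both in subgroups larger than `D`. -/
theorem inf_eq_bot_of_isCoatom [Finite G] (h : ∀ H : Subgroup G, H ≠ ⊤ → Group.IsNilpotent H)
    (hs : ∀ N : Subgroup G, N.Normal → N = ⊥ ∨ N = ⊤) {H K : Subgroup G} (hH : IsCoatom H)
    (hK : IsCoatom K) (hHK : H ≠ K) : H ⊓ K = ⊥ := by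
  by_contra hne
  let s : Set (Subgroup G) :=
    {D | ∃ H K : Subgroup G, IsCoatom H ∧ IsCoatom K ∧ H ≠ K ∧ D = H ⊓ K ∧ D ≠ ⊥}
  obtain ⟨D, hD⟩ := s.toFinite.exists_maximal ⟨H ⊓ K, H, K, hH, hK, hHK, rfl, hne⟩
  obtain ⟨H₁, H₂, h₁, h₂, h₁₂, hDeq, hDne⟩ := hD.1
  have hN : normalizer (D : Set G) ≠ ⊤ := by
    intro hN
    rcases hs D (normalizer_eq_top_iff.mp hN) with hD' | hD'
    · exact hDne hD'
    · exact h₁.1 (top_le_iff.mp (hD' ▸ hDeq ▸ inf_le_left))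
  obtain ⟨L, hL, hNL⟩ := (eq_top_or_exists_le_coatom _).resolve_left hN
  have key : ∀ P : Subgroup G, IsCoatom P → D < P → L = P := by
    intro P hP hDP
    by_contra hLP
    have := h P hP.1
    have hlt : D.subgroupOf P < ⊤ := by
      rw [lt_top_iff_ne_top, Ne, subgroupOf_eq_top]
      exact hDP.not_ge
    obtain ⟨g, hg, hgD⟩ :=
      SetLike.exists_of_lt (Group.normalizerCondition_of_isNilpotent (G := P) _ hlt)
    have hgN : (g : G) ∈ normalizer (D : Set G) := by
      rw [mem_normalizer_iff] at hg ⊢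
      intro k
      constructor
      · intro hk
        exact (hg ⟨k, hDP.le hk⟩).mp hk
      · intro hk
        have hkP : k ∈ P := by
          have := P.mul_mem (P.mul_mem (P.inv_mem g.2) (hDP.le hk)) g.2
          simpa [mul_assoc] using this
        exact (hg ⟨k, hkP⟩).mpr hk
    have hle : D ≤ L ⊓ P := le_inf (le_normalizer.trans hNL) hDP.le
    have hmem : L ⊓ P ∈ s := by
      refine ⟨L, P, hL, hP, hLP, rfl, fun hbot => hDne ?_⟩
      exact le_bot_iff.mp (hbot ▸ hle)
    exact hgD (hD.2 hmem hle ⟨hNL hgN, g.2⟩)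
  have hlt₁ : D < H₁ := by
    refine lt_of_le_of_ne (hDeq ▸ inf_le_left) fun he => ?_
    have : H₁ ≤ H₂ := by rw [← he, hDeq]; exact inf_le_right
    exact h₂.1 (h₁.2 H₂ (this.lt_of_ne h₁₂))
  have hlt₂ : D < H₂ := by
    refine lt_of_le_of_ne (hDeq ▸ inf_le_right) fun he => ?_
    have : H₂ ≤ H₁ := by rw [← he, hDeq]; exact inf_le_left
    exact h₁.1 (h₂.2 H₁ (this.lt_of_ne h₁₂.symm))
  exact h₁₂ ((key H₁ h₁ hlt₁).symm.trans (key H₂ h₂ hlt₂))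

/-- The conjugates of the nontrivial elements of `H`, parametrized by the cosets of `H`. -/
noncomputable def conjFamily (H : Subgroup G) (p : (G ⧸ H) × {m : H // m ≠ 1}) : {g : G // g ≠ 1} :=
  ⟨p.1.out * p.2.1 * p.1.out⁻¹, by
    intro h
    apply p.2.2
    ext
    simpa using h⟩

theorem mem_range_conjFamily {H : Subgroup G} {g m : G} (hm : m ∈ H) (h : g * m * g⁻¹ ≠ 1) :
    ∃ p, (conjFamily H p : G) = g * m * g⁻¹ := by
  obtain ⟨k, hk⟩ := QuotientGroup.mk_out_eq_mul H g
  refine ⟨(g, ⟨⟨(k : G)⁻¹ * m * k, H.mul_mem (H.mul_mem (H.inv_mem k.2) hm) k.2⟩, ?_⟩), ?_⟩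
  · intro h1
    apply h
    have h2 : (k : G)⁻¹ * m * k = 1 := congrArg Subtype.val h1
    have h3 : m = 1 := by
      calc m = k * ((k : G)⁻¹ * m * k) * (k : G)⁻¹ := by group
        _ = 1 := by rw [h2]; group
    simp [h3]
  · simp only [conjFamily, hk]
    group

theorem card_conjFamily [Finite G] (H : Subgroup G) :
    Nat.card ((G ⧸ H) × {m : H // m ≠ 1}) + H.index = Nat.card G := by
  have : Nat.card {m : H // m ≠ 1} + 1 = Nat.card H := by
    have := Fintype.ofFinite H
    classical
    rw [Nat.card_eq_fintype_card, Nat.card_eq_fintype_card, Fintype.card_subtype_compl,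
      Fintype.card_subtype_eq]
    exact Nat.sub_add_cancel Fintype.card_pos
  rw [Nat.card_prod, ← H.card_mul_index, ← this, Subgroup.index]
  ring

/-- A noncommutative finite group with nilpotent proper subgroups is not simple. Otherwise the
maximal subgroups would intersect trivially, so that the conjugates of a single one would contain
at least half of the elements without exhausting the group, and two classes of conjugates would
contain too many. -/
theorem exists_normal_of_forall_isNilpotent [Finite G]
    (h : ∀ H : Subgroup G, H ≠ ⊤ → Group.IsNilpotent H) (hG : ¬ ∀ a b : G, a * b = b * a) :
    ∃ N : Subgroup G, N.Normal ∧ N ≠ ⊥ ∧ N ≠ ⊤ := by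
  by_contra! hs'
  have hs : ∀ N : Subgroup G, N.Normal → N = ⊥ ∨ N = ⊤ := fun N hN => by
    by_cases hb : N = ⊥
    · exact Or.inl hb
    · exact Or.inr (hs' N hN hb)
  have hcyc : ∀ g : G, zpowers g ≠ ⊤ := by
    intro g hg
    refine hG fun a b => ?_
    obtain ⟨k, rfl⟩ := mem_zpowers_iff.mp (hg ▸ mem_top a)
    obtain ⟨l, rfl⟩ := mem_zpowers_iff.mp (hg ▸ mem_top b)
    exact zpow_mul_comm g k l
  have hcoatom : ∀ g : G, ∃ H : Subgroup G, IsCoatom H ∧ g ∈ H := by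
    intro g
    obtain ⟨H, hH, hgH⟩ := (eq_top_or_exists_le_coatom (zpowers g)).resolve_left (hcyc g)
    exact ⟨H, hH, hgH (mem_zpowers g)⟩
  have hbot : ∀ H : Subgroup G, IsCoatom H → H ≠ ⊥ := by
    rintro _ hH rfl
    refine hG fun a b => ?_
    have ha : a = 1 := by
      by_contra ha
      exact hcyc a (hH.2 _ (bot_lt_iff_ne_bot.mpr (by simpa using ha)))
    simp [ha]
  have hconj : ∀ H K : Subgroup G, IsCoatom H → IsCoatom K → ∀ g m : G, m ∈ H → m ≠ 1 →
      g * m * g⁻¹ ∈ K → H.map (MulAut.conj g).toMonoidHom = K := by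
    intro H K hH hK g m hm hm1 hgm
    by_contra hne
    have h1 := inf_eq_bot_of_isCoatom h hs (isCoatom_map_conj hH g) hK hne
    have h2 : g * m * g⁻¹ ∈ (⊥ : Subgroup G) := h1 ▸ ⟨⟨m, hm, by simp⟩, hgm⟩
    exact hm1 (by simpa using h2)
  have hnorm : ∀ H : Subgroup G, IsCoatom H → normalizer (H : Set G) = H := by
    intro H hH
    by_contra hne
    have h1 := hH.2 _ (le_normalizer.lt_of_ne' hne)
    rcases hs H (normalizer_eq_top_iff.mp h1) with h2 | h2
    · exact hbot H hH h2
    · exact hH.1 h2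
  have hinj : ∀ H : Subgroup G, IsCoatom H → Function.Injective (conjFamily H) := by
    rintro H hH ⟨q, ⟨m, hm⟩⟩ ⟨q', ⟨m', hm'⟩⟩ heq
    have heq' : q.out * (m : G) * q.out⁻¹ = q'.out * m' * q'.out⁻¹ := congrArg Subtype.val heq
    have h1 : q'.out⁻¹ * q.out * (m : G) * (q'.out⁻¹ * q.out)⁻¹ = m' := by
      calc _ = q'.out⁻¹ * (q.out * (m : G) * q.out⁻¹) * q'.out := by group
        _ = m' := by rw [heq']; group
    have h2 := hconj H H hH hH _ m m.2 (by simpa using hm) (h1 ▸ m'.2)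
    have h3 := mem_normalizer_of_map_conj_eq h2
    rw [hnorm H hH] at h3
    have h4 : q = q' := by
      rw [← q.out_eq', ← q'.out_eq']
      exact (QuotientGroup.eq.mpr h3).symm
    subst h4
    have h5 : m = m' := by
      ext
      simpa using heq'
    subst h5
    rfl
  have hcard1 : Nat.card {g : G // g ≠ 1} + 1 = Nat.card G := by
    have := Fintype.ofFinite G
    classical
    rw [Nat.card_eq_fintype_card, Nat.card_eq_fintype_card, Fintype.card_subtype_compl,
      Fintype.card_subtype_eq]
    exact Nat.sub_add_cancel Fintype.card_pos
  have hindex : ∀ H : Subgroup G, IsCoatom H → 2 * H.index ≤ Nat.card G := by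
    intro H hH
    have := Subgroup.one_lt_card_iff_ne_bot H |>.mpr (hbot H hH)
    rw [← H.card_mul_index]
    exact Nat.mul_le_mul_right _ this
  obtain ⟨H, hH, -⟩ := hcoatom 1
  obtain ⟨g, hg⟩ : ∃ g : {g : G // g ≠ 1}, g ∉ Set.range (conjFamily H) := by
    by_contra! hsurj
    have h1 := Nat.card_le_card_of_surjective (conjFamily H) hsurj
    have h2 := card_conjFamily H
    have h3 := Subgroup.one_lt_index_of_ne_top hH.1
    omega
  obtain ⟨K, hK, hgK⟩ := hcoatom g
  have hdisj : ∀ p q, conjFamily H p ≠ conjFamily K q := by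
    rintro ⟨q, ⟨m, hm⟩⟩ ⟨q', ⟨m', hm'⟩⟩ heq
    have heq' : q.out * (m : G) * q.out⁻¹ = q'.out * m' * q'.out⁻¹ := congrArg Subtype.val heq
    have h1 : q'.out⁻¹ * q.out * (m : G) * (q'.out⁻¹ * q.out)⁻¹ = m' := by
      calc _ = q'.out⁻¹ * (q.out * (m : G) * q.out⁻¹) * q'.out := by group
        _ = m' := by rw [heq']; group
    have h2 := hconj H K hH hK _ m m.2 (by simpa using hm) (h1 ▸ m'.2)
    rw [← h2] at hgK
    obtain ⟨l, hl, hlg⟩ := hgK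
    have hlg' : q'.out⁻¹ * q.out * l * (q'.out⁻¹ * q.out)⁻¹ = g := by
      simpa [mul_assoc] using hlg
    obtain ⟨p, hp⟩ := mem_range_conjFamily hl (by rw [hlg']; exact g.2)
    exact hg ⟨p, Subtype.ext (hp.trans hlg')⟩
  have hsum : Function.Injective (Sum.elim (conjFamily H) (conjFamily K)) :=
    (hinj H hH).sumElim (hinj K hK) hdisj
  have h1 := Nat.card_le_card_of_injective _ hsum
  rw [Nat.card_sum] at h1
  have h2 := card_conjFamily H
  have h3 := card_conjFamily K
  have h4 := hindex H hH
  have h5 := hindex K hK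
  omega

end Simple

section Nilpotent

/-- An automorphism `T` of a finite elementary abelian `p`-group such that `(1 - T)(1 - T⁻¹)` is
locally nilpotent has order a power of `p`: the ring generated by `T` has characteristic `p`, and
`1 - T` is nilpotent in it. -/
theorem exists_pow_prime_pow_eq_one {V : Type*} [AddCommGroup V] [Finite V] {p : ℕ}
    (hp : p.Prime) (hV : ∀ v : V, p • v = 0) {T T' : AddMonoid.End V} (hT : T * T' = 1)
    (hT' : T' * T = 1) (h : ∀ v, ∃ n : ℕ, (((1 - T) * (1 - T')) ^ n) v = 0) :
    ∃ k : ℕ, T ^ p ^ k = 1 := by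
  choose n hn using h
  obtain ⟨N, hN⟩ := (Set.finite_range n).bddAbove
  have hE : ((1 - T) * (1 - T')) ^ N = 0 := by
    ext v
    have hle : n v ≤ N := hN ⟨v, rfl⟩
    obtain ⟨d, rfl⟩ := Nat.exists_eq_add_of_le' hle
    rw [pow_add]
    change (((1 - T) * (1 - T')) ^ d) ((((1 - T) * (1 - T')) ^ n v) v) = 0
    rw [hn, map_zero]
  have hc : Commute T T' := hT.trans hT'.symm
  have hc1 : Commute T (1 - T) := (Commute.one_right T).sub_right (Commute.refl T)
  have hc2 : Commute T (1 - T') := (Commute.one_right T).sub_right hc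
  have hsq : (1 - T) ^ 2 = -T * ((1 - T) * (1 - T')) := by
    rw [← mul_assoc, neg_mul, hc1.eq, neg_mul, mul_assoc, mul_sub T, hT, mul_one, sq, ← mul_neg,
      neg_sub]
  have hnil : (1 - T) ^ (2 * N) = 0 := by
    rw [pow_mul, hsq, (hc1.mul_right hc2).neg_left.mul_pow, hE, mul_zero]
  have hnil' : (1 - T) ^ p ^ (2 * N) = 0 :=
    pow_eq_zero_of_le (Nat.lt_pow_self hp.one_lt).le hnil
  have hp0 : (p : AddMonoid.End V) = 0 := by
    ext v
    simpa using hV v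
  obtain ⟨r, hr⟩ := hc1.exists_add_pow_prime_pow_eq hp (2 * N)
  refine ⟨2 * N, ?_⟩
  rw [hnil', hp0] at hr
  simpa using hr.symm

variable {G : Type*} [Group G]

/-- The map `(y_1, y_2) ↦ (λ_{1,1}, λ_{1,2}) = (y_1 z y_2, y_2 z y_1)`. -/
def pairStep (z : G) (q : G × G) : G × G := (q.1 * z * q.2, q.2 * z * q.1)

/-- The two components of every pair become equal when two steps `pairStep u` and `pairStep v` are
applied alternately: the case `t = 2` of the pseudoidentities. -/
def PairsCollapse (G : Type*) [Group G] : Prop :=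
  ∀ (u v : G) (q : G × G), ∃ n : ℕ,
    ((fun r => pairStep v (pairStep u r))^[n] q).1
      = ((fun r => pairStep v (pairStep u r))^[n] q).2

theorem map_pairStep_iterate {H : Type*} [Group H] (f : G →* H) (u v : G) (q : G × G) (n : ℕ) :
    Prod.map f f (((fun r => pairStep v (pairStep u r))^[n]) q)
      = ((fun r => pairStep (f v) (pairStep (f u) r))^[n]) (Prod.map f f q) := by
  refine Function.Semiconj.iterate_right (f := Prod.map f f) (fun r => ?_) n q
  simp [pairStep]

theorem PairsCollapse.of_injective {H : Type*} [Group H] (f : G →* H)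
    (hf : Function.Injective f) (hH : PairsCollapse H) : PairsCollapse G := by
  intro u v q
  obtain ⟨n, hn⟩ := hH (f u) (f v) (Prod.map f f q)
  rw [← map_pairStep_iterate] at hn
  exact ⟨n, hf hn⟩

theorem PairsCollapse.of_surjective {H : Type*} [Group H] (f : G →* H)
    (hf : Function.Surjective f) (hG : PairsCollapse G) : PairsCollapse H := by
  intro u v q
  obtain ⟨u, rfl⟩ := hf u
  obtain ⟨v, rfl⟩ := hf v
  obtain ⟨q, rfl⟩ := (hf.prodMap hf) q
  obtain ⟨n, hn⟩ := hG u v q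
  refine ⟨n, ?_⟩
  rw [← map_pairStep_iterate]
  exact congrArg f hn

/-- If pairs collapse, every element acts by conjugation on an abelian normal subgroup `A` like the
automorphism `T` of `exists_pow_prime_pow_eq_one`. The pair to start with is `(c, 1)`, and the steps
are given by `u = h` and `v = c⁻¹ h⁻²`. Modulo `A`, where the pairs are trivial, the value of `v` is
`h⁻²`; thus `(a b, b)` with `a, b ∈ A` is mapped to `(a' b', b')`, where `b' ∈ A` and `a'` is the
image of `a` under `(1 - T)(1 - T⁻¹)`, `T` being conjugation by `h`. -/
theorem PairsCollapse.conj_locally_nilpotent (hG : PairsCollapse G) {A : Subgroup G}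
    [hA : A.Normal] (hcomm : ∀ a ∈ A, ∀ b ∈ A, a * b = b * a) (h : G) {c : G} (hc : c ∈ A) :
    ∃ n : ℕ, (fun a => (a * (h * a⁻¹ * h⁻¹)) * (h⁻¹ * (a * (h * a⁻¹ * h⁻¹))⁻¹ * h))^[n] c = 1 := by
  set E : G → G := fun a => (a * (h * a⁻¹ * h⁻¹)) * (h⁻¹ * (a * (h * a⁻¹ * h⁻¹))⁻¹ * h) with hE
  have hconj' : ∀ a ∈ A, h⁻¹ * a * h ∈ A := fun a ha => by simpa using hA.conj_mem a ha h⁻¹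
  have hD : ∀ a ∈ A, a * (h * a⁻¹ * h⁻¹) ∈ A := fun a ha =>
    A.mul_mem ha (hA.conj_mem _ (A.inv_mem ha) h)
  have hEA : ∀ a ∈ A, E a ∈ A := fun a ha =>
    A.mul_mem (hD a ha) (hconj' _ (A.inv_mem (hD a ha)))
  have conj_eq : ∀ a ∈ A, ∀ b ∈ A, a * b * a⁻¹ = b := fun a ha b hb => by
    rw [hcomm a ha b hb, mul_inv_cancel_right]
  have step : ∀ c' ∈ A, ∀ b ∈ A, ∃ b' ∈ A,
      pairStep (c⁻¹ * h⁻¹ * h⁻¹) (pairStep h (c' * b, b)) = (E c' * b', b') := by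
    intro c' hc' b hb
    set d := c' * (h * c'⁻¹ * h⁻¹) with hd
    have hdA : d ∈ A := hD c' hc'
    set α := b * (h * (c' * b * c⁻¹) * h⁻¹) with hα
    have hαA : α ∈ A :=
      A.mul_mem hb (hA.conj_mem _ (A.mul_mem (A.mul_mem hc' hb) (A.inv_mem hc)) h)
    have h1 : c' * b * h * b = d * (b * h * (c' * b)) := by
      have := conj_eq b hb (h * c'⁻¹ * h⁻¹) (hA.conj_mem _ (A.inv_mem hc') h)
      calc c' * b * h * b = c' * (b * (h * c'⁻¹ * h⁻¹) * b⁻¹) * (b * h * (c' * b)) := by group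
        _ = _ := by rw [this]
    have h2 : b * h * (c' * b) * (c⁻¹ * h⁻¹ * h⁻¹) = α * h⁻¹ := by rw [hα]; group
    refine ⟨α * (h⁻¹ * (d * b) * h) * (c' * b), ?_, ?_⟩
    · exact A.mul_mem (A.mul_mem hαA (hconj' _ (A.mul_mem hdA hb))) (A.mul_mem hc' hb)
    · have h3 := conj_eq α hαA (h⁻¹ * d⁻¹ * h) (hconj' _ (A.inv_mem hdA))
      have h4 : b * h * (c' * b) * (c⁻¹ * h⁻¹ * h⁻¹) * (d * (b * h * (c' * b)))
          = α * (h⁻¹ * (d * b) * h) * (c' * b) := by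
        rw [h2]; group
      simp only [pairStep, h1]
      refine Prod.ext ?_ h4
      change d * (b * h * (c' * b)) * (c⁻¹ * h⁻¹ * h⁻¹) * (b * h * (c' * b)) = E c' * _
      calc d * (b * h * (c' * b)) * (c⁻¹ * h⁻¹ * h⁻¹) * (b * h * (c' * b))
          = d * (b * h * (c' * b) * (c⁻¹ * h⁻¹ * h⁻¹)) * (b * h * (c' * b)) := by
            simp only [mul_assoc]
        _ = d * (α * (h⁻¹ * d⁻¹ * h) * α⁻¹) * (α * (h⁻¹ * (d * b) * h) * (c' * b)) := by
            rw [h2]; group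
        _ = d * (h⁻¹ * d⁻¹ * h) * (α * (h⁻¹ * (d * b) * h) * (c' * b)) := by rw [h3]
  obtain ⟨n, hn⟩ := hG h (c⁻¹ * h⁻¹ * h⁻¹) (c, 1)
  refine ⟨n, ?_⟩
  have key : ∀ n : ℕ, E^[n] c ∈ A ∧ ∃ b ∈ A,
      (fun r => pairStep (c⁻¹ * h⁻¹ * h⁻¹) (pairStep h r))^[n] (c, 1) = (E^[n] c * b, b) := by
    intro n
    induction n with
    | zero => exact ⟨hc, 1, A.one_mem, by simp⟩
    | succ n ih =>
      obtain ⟨hn, b, hb, he⟩ := ih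
      obtain ⟨b', hb', he'⟩ := step _ hn b hb
      rw [Function.iterate_succ_apply', Function.iterate_succ_apply', he]
      exact ⟨hEA _ hn, b', hb', he'⟩
  obtain ⟨-, b, -, he⟩ := key n
  rw [he] at hn
  exact mul_eq_right.mp hn

open Subgroup

/-- If pairs collapse, a nilpotent nontrivial normal subgroup `N` yields a nontrivial center: the
group acts as a `p`-group on the `p`-torsion of the center of `N`. -/
theorem PairsCollapse.center_ne_bot [Finite G] (hG : PairsCollapse G) {N : Subgroup G}
    [N.Normal] (hN : N ≠ ⊥) [Group.IsNilpotent N] : center G ≠ ⊥ := by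
  let Z : Subgroup G := (center N).map N.subtype
  have hZn : Z.Normal := inferInstance
  have hZcomm : ∀ a ∈ Z, ∀ b ∈ Z, a * b = b * a := by
    rintro _ ⟨a, ha, rfl⟩ _ ⟨b, hb, rfl⟩
    exact congrArg N.subtype (mem_center_iff.mp hb a)
  have hZ1 : Nat.card Z ≠ 1 := by
    have := (nontrivial_iff_ne_bot N).mpr hN
    have hne : center N ≠ ⊥ := Group.IsNilpotent.center_ne_bot N
    rw [Ne, card_eq_one]
    intro h
    exact hne ((map_eq_bot_iff_of_injective _ N.subtype_injective).mp h)
  obtain ⟨p, hp, hpZ⟩ := Nat.exists_prime_and_dvd hZ1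
  have : Fact p.Prime := ⟨hp⟩
  let A : Subgroup G :=
    { carrier := {a | a ∈ Z ∧ a ^ p = 1}
      one_mem' := ⟨Z.one_mem, one_pow _⟩
      mul_mem' := fun {a b} ha hb => ⟨Z.mul_mem ha.1 hb.1, by
        rw [(show Commute a b from hZcomm a ha.1 b hb.1).mul_pow, ha.2, hb.2, one_mul]⟩
      inv_mem' := fun {a} ha => ⟨Z.inv_mem ha.1, by rw [inv_pow, ha.2, inv_one]⟩ }
  have hA : A.Normal := ⟨fun a ha g => ⟨hZn.conj_mem a ha.1 g, by
    rw [conj_pow, ha.2, mul_one, mul_inv_cancel]⟩⟩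
  have hAcomm : ∀ a ∈ A, ∀ b ∈ A, a * b = b * a := fun a ha b hb => hZcomm a ha.1 b hb.1
  have hpA : p ∣ Nat.card A := by
    obtain ⟨a, ha⟩ := exists_prime_orderOf_dvd_card' p hpZ
    have haA : (a : G) ∈ A := ⟨a.2, by
      have := pow_orderOf_eq_one a
      rw [ha] at this
      exact congrArg Subtype.val this⟩
    have : orderOf (⟨a, haA⟩ : A) = p := by
      rw [← ha, ← orderOf_coe a, ← orderOf_coe]
    rw [← this]
    exact orderOf_dvd_natCard _
  let _ : CommGroup A :=
    { (inferInstance : Group A) with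
      mul_comm := fun a b => Subtype.ext (hAcomm a a.2 b b.2) }
  let T : G → AddMonoid.End (Additive A) := fun g =>
    { toFun := fun a => Additive.ofMul (MulAut.conjNormal g a.toMul)
      map_zero' := map_one (MulAut.conjNormal g)
      map_add' := fun a b => map_mul (MulAut.conjNormal g) a.toMul b.toMul }
  have hT_mul : ∀ g g', T (g * g') = T g * T g' := by
    intro g g'
    refine DFunLike.ext _ _ fun a => ?_
    exact congrArg Additive.ofMul (DFunLike.congr_fun (map_mul MulAut.conjNormal g g') a.toMul)
  have hT1 : T 1 = 1 := by
    refine DFunLike.ext _ _ fun a => ?_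
    exact congrArg Additive.ofMul (DFunLike.congr_fun (map_one MulAut.conjNormal) a.toMul)
  have hT_pow : ∀ g (n : ℕ), T (g ^ n) = T g ^ n := by
    intro g n
    induction n with
    | zero => simpa using hT1
    | succ n ih => rw [pow_succ, pow_succ, hT_mul, ih]
  have hpow : ∀ g, ∃ k : ℕ, T g ^ p ^ k = 1 := by
    intro g
    have hgg : T g * T g⁻¹ = 1 := by rw [← hT_mul, mul_inv_cancel, hT1]
    have hgg' : T g⁻¹ * T g = 1 := by rw [← hT_mul, inv_mul_cancel, hT1]
    refine exists_pow_prime_pow_eq_one hp (fun a => ?_) hgg hgg' fun a => ?_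
    · exact Additive.toMul.injective (Subtype.ext a.toMul.2.2)
    · obtain ⟨n, hn⟩ := hG.conj_locally_nilpotent hAcomm g⁻¹ a.toMul.2
      refine ⟨n, Additive.toMul.injective (Subtype.ext (Eq.trans ?_ hn))⟩
      clear hn
      induction n with
      | zero => rfl
      | succ n ih =>
        rw [pow_succ', Function.iterate_succ_apply', ← ih]
        have hmul : ∀ X Y : AddMonoid.End (Additive A), (X * Y) a = X (Y a) := fun _ _ => rfl
        rw [hmul]
        generalize (((1 - T g) * (1 - T g⁻¹)) ^ n) a = b
        change (((b - T g⁻¹ b) - T g (b - T g⁻¹ b)).toMul : G) = _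
        have hdiv : ∀ a b : Additive A,
            ((a - b).toMul : G) = (a.toMul : G) * (b.toMul : G)⁻¹ := fun a b => by
          rw [toMul_sub, div_eq_mul_inv]
          rfl
        have hTa : ∀ (g : G) (a : Additive A), ((T g a).toMul : G) = g * a.toMul * g⁻¹ :=
          fun g a => MulAut.conjNormal_apply g a.toMul
        simp only [hdiv, hTa]
        group
  have hP : IsPGroup p (MulAut.conjNormal : G →* MulAut A).range := by
    rintro ⟨_, g, rfl⟩
    obtain ⟨k, hk⟩ := hpow g
    refine ⟨k, Subtype.ext ?_⟩
    ext a
    have h1 := DFunLike.congr_fun (hT_pow g (p ^ k)) (Additive.ofMul a)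
    rw [hk] at h1
    change ((MulAut.conjNormal g ^ p ^ k : MulAut A) a : G) = a
    rw [← map_pow]
    exact congrArg (fun b : Additive A => (b.toMul : G)) h1
  obtain ⟨b, hb, hb1⟩ := hP.exists_fixed_point_of_prime_dvd_card_of_fixed_point A hpA (a := 1)
    (fun f => map_one (f : MulAut A))
  intro hbot
  have hbc : (b : G) ∈ center G := by
    rw [mem_center_iff]
    intro g
    have h1 : MulAut.conjNormal g b = b := hb ⟨_, g, rfl⟩
    have h2 := congrArg Subtype.val h1
    rw [MulAut.conjNormal_apply] at h2
    exact mul_inv_eq_iff_eq_mul.mp h2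
  rw [hbot, mem_bot] at hbc
  exact hb1 (Subtype.ext hbc.symm)

theorem card_quotient_center_lt [Finite G] (h : center G ≠ ⊥) :
    Nat.card (G ⧸ center G) < Nat.card G := by
  have h1 := (one_lt_card_iff_ne_bot (center G)).mpr h
  have h2 : 0 < Nat.card (G ⧸ center G) := Nat.card_pos
  rw [Subgroup.card_eq_card_quotient_mul_card_subgroup (center G)]
  nlinarith

/-- A minimal counterexample would have a proper normal subgroup, hence a nontrivial center. -/
theorem PairsCollapse.isNilpotent [Finite G] (hG : PairsCollapse G) : Group.IsNilpotent G := by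
  obtain ⟨n, hn⟩ : ∃ n, Nat.card G = n := ⟨_, rfl⟩
  induction n using Nat.strong_induction_on generalizing G with
  | _ n ih =>
    by_cases hcomm : ∀ a b : G, a * b = b * a
    · let _ : CommGroup G := { (inferInstance : Group G) with mul_comm := hcomm }
      exact CommGroup.isNilpotent
    have hsub : ∀ H : Subgroup G, H ≠ ⊤ → Group.IsNilpotent H := by
      intro H hH
      refine ih (Nat.card H) ?_ (hG.of_injective H.subtype H.subtype_injective) rfl
      rw [← hn]
      exact lt_of_le_of_ne (Subgroup.card_le_card_group H) fun h => hH (H.eq_top_of_card_eq h)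
    obtain ⟨N, hN, hNb, hNt⟩ := exists_normal_of_forall_isNilpotent hsub hcomm
    have := hsub N hNt
    have hZ := hG.center_ne_bot hNb
    refine Group.of_quotient_center_nilpotent (ih _ ?_
      (hG.of_surjective (QuotientGroup.mk' _) (QuotientGroup.mk'_surjective _)) rfl)
    rw [← hn]
    exact card_quotient_center_lt hZ

end Nilpotent

/-! ### The elements `λ_{n,i}` in nilpotent groups -/

section NilpotentCollapse

open Subgroup
open scoped IsMulCommutative

variable {G : Type*} [Group G]

theorem cyclicProd_eq_of_center {a : ℤ → G} {c : ℤ → center G} {b : G}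
    (h : ∀ i, a i = c i * b) (z : G) (i : ℤ) (k : ℕ) :
    cyclicProd a z i k
      = (∏ l ∈ Finset.range (k + 1), c (i + l) : center G) * ((b * z) ^ k * b) := by
  induction k with
  | zero => simp [cyclicProd, h]
  | succ k ih =>
    rw [cyclicProd, ih, Finset.prod_range_succ _ (k + 1), h, coe_mul]
    have h1 := mem_center_iff.mp (c (i + (k + 1 : ℕ))).2 ((b * z) ^ k * b * z)
    generalize ((∏ l ∈ Finset.range (k + 1), c (i + l) : center G) : G) = d
    calc d * ((b * z) ^ k * b) * z * (c (i + (k + 1 : ℕ)) * b)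
        = d * ((b * z) ^ k * b * z * c (i + (k + 1 : ℕ))) * b := by simp only [mul_assoc]
      _ = d * (c (i + (k + 1 : ℕ)) * ((b * z) ^ k * b * z)) * b := by rw [h1]
      _ = _ := by rw [pow_succ]; simp only [mul_assoc]

theorem prod_range_periodic {Z : Type*} [CommMonoid Z] {t : ℕ} {c : ℤ → Z}
    (hc : ∀ i, c (i + t) = c i) (i j : ℤ) :
    ∏ l ∈ Finset.range t, c (i + l) = ∏ l ∈ Finset.range t, c (j + l) := by
  have key : ∀ i : ℤ, ∏ l ∈ Finset.range t, c (i + 1 + l) = ∏ l ∈ Finset.range t, c (i + l) := by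
    intro i
    rcases t with _ | t
    · rfl
    rw [Finset.prod_range_succ, Finset.prod_range_succ']
    congr 1
    · refine Finset.prod_congr rfl fun l _ => ?_
      congr 1
      push_cast
      ring
    · rw [Nat.cast_zero, add_zero, ← hc i]
      congr 1
      push_cast
      ring
  have := rel_of_rel_succ (r := Eq) (fun _ => rfl) Eq.symm Eq.trans
    (f := fun i => ∏ l ∈ Finset.range t, c (i + l)) (m := 1) key (i - j) j
  simpa using this

/-- In a nilpotent group the `λ_{n,i}` become equal: once they are equal modulo the center, one more
step multiplies all the central factors together. The bound on `n` depends neither on `t` nor on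
the `x_i` and `z_i`. -/
theorem cyclicLambda_const_of_isNilpotent (G : Type*) [Group G] [Group.IsNilpotent G] [Finite G]
    {t : ℕ} (ht : 0 < t) {x : ℤ → G} (hx : ∀ i, x (i + t) = x i) (z : ℕ → G) (i j : ℤ) :
    cyclicLambda t x z (Nat.card G) i = cyclicLambda t x z (Nat.card G) j := by
  obtain ⟨n, hn⟩ : ∃ n, Nat.card G = n := ⟨_, rfl⟩
  induction n using Nat.strong_induction_on generalizing G i j with
  | _ n ih =>
    cases subsingleton_or_nontrivial G with
    | inl hG => exact Subsingleton.elim _ _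
    | inr hG =>
      have hlt := card_quotient_center_lt (Group.IsNilpotent.center_ne_bot G)
      have h1 := ih _ (hn ▸ hlt) (G ⧸ center G) (x := fun i => (x i : G ⧸ center G))
        (fun i => by rw [hx]) (fun k => (z k : G ⧸ center G))
      set m := Nat.card (G ⧸ center G)
      have h2 : ∀ i j, QuotientGroup.mk' (center G) (cyclicLambda t x z m i)
          = QuotientGroup.mk' (center G) (cyclicLambda t x z m j) := by
        intro i j
        have h3 := map_cyclicLambda (QuotientGroup.mk' (center G) : G →ₙ* G ⧸ center G) t x z m
        have hi := (h3 i).trans ((h1 i j rfl).trans (h3 j).symm)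
        exact hi
      let b := cyclicLambda t x z m 0
      let c : ℤ → center G := fun i => ⟨cyclicLambda t x z m i * b⁻¹, by
        have := (QuotientGroup.eq.mp (h2 i 0))
        have h4 := (inferInstance : (center G).Normal).conj_mem _
          ((center G).inv_mem this) (cyclicLambda t x z m i)
        simpa [b, mul_assoc] using h4⟩
      have hc : ∀ i, c (i + t) = c i := fun i => Subtype.ext
        (congrArg (· * b⁻¹) (cyclicLambda_periodic hx z m i))
      have hb : ∀ i, cyclicLambda t x z m i = c i * b := fun i => by simp [c]
      refine cyclicLambda_const_of_le (n := m + 1) hlt (fun i j => ?_) i j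
      change cyclicProd _ _ _ _ = cyclicProd _ _ _ _
      rw [cyclicProd_eq_of_center hb, cyclicProd_eq_of_center hb, Nat.sub_add_cancel ht,
        prod_range_periodic hc i j]

end NilpotentCollapse

/-! ### The group of units of a local submonoid -/

section LocalMonoid

variable {M : Type*} [Monoid M]

/-- The submonoid `eMe` of `M` with identity `e`, for an idempotent `e`. -/
def LocalMonoid (e : M) (_ : e * e = e) : Type _ := {a : M // e * a = a ∧ a * e = a}

instance (e : M) (he : e * e = e) : Monoid (LocalMonoid e he) where
  mul a b := ⟨a.1 * b.1, by rw [← mul_assoc, a.2.1], by rw [mul_assoc, b.2.2]⟩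
  mul_assoc a b c := Subtype.ext (mul_assoc a.1 b.1 c.1)
  one := ⟨e, he, he⟩
  one_mul a := Subtype.ext a.2.1
  mul_one a := Subtype.ext a.2.2

/-- The inclusion of the group of units of `eMe` in `M`. -/
def unitsVal {e : M} {he : e * e = e} : (LocalMonoid e he)ˣ →ₙ* M where
  toFun a := a.1.1
  map_mul' _ _ := rfl

theorem unitsVal_injective {e : M} {he : e * e = e} :
    Function.Injective (unitsVal : (LocalMonoid e he)ˣ →ₙ* M) :=
  fun _ _ h => Units.ext (Subtype.ext h)

theorem exists_unitsVal_eq [Finite M] {e : M} (he : e * e = e) {a : M} (h1 : e * a = a)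
    (h2 : a * e = a) (h : GreenJ a e) : ∃ g : (LocalMonoid e he)ˣ, unitsVal g = a := by
  obtain ⟨u, hu⟩ := (h1.symm ▸ h : GreenJ (e * a) e).greenR_mul.2
  obtain ⟨v, hv⟩ := (h2.symm ▸ h : GreenJ (a * e) e).greenL_mul.2
  rw [h1] at hu
  rw [h2] at hv
  let a' : LocalMonoid e he := ⟨a, h1, h2⟩
  let u' : LocalMonoid e he := ⟨e * u * e, by simp only [← mul_assoc, he], by rw [mul_assoc, he]⟩
  let v' : LocalMonoid e he := ⟨e * v * e, by simp only [← mul_assoc, he], by rw [mul_assoc, he]⟩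
  have hau : a' * u' = 1 := Subtype.ext (by
    change a * (e * u * e) = e
    rw [← mul_assoc, ← mul_assoc, h2, ← hu, he])
  have hva : v' * a' = 1 := Subtype.ext (by
    change e * v * e * a = e
    rw [mul_assoc, h1, mul_assoc, ← hv, he])
  have huv : v' = u' := left_inv_eq_right_inv hva hau
  exact ⟨⟨a', u', hau, huv ▸ hva⟩, rfl⟩

end LocalMonoid

section GroupCollapse

theorem exists_cyclicProd_eq {M : Type*} [Monoid M] (a : ℤ → M) (w : M) (i : ℤ) (k : ℕ) :
    (∃ u, cyclicProd a w i k = a i * u) ∧ ∃ u, cyclicProd a w i k = u * a (i + k) := by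
  induction k with
  | zero => exact ⟨⟨1, by simp [cyclicProd]⟩, 1, by simp [cyclicProd]⟩
  | succ k ih =>
    obtain ⟨u, hu⟩ := ih.1
    exact ⟨⟨u * w * a (i + (k + 1 : ℕ)), by rw [cyclicProd, hu]; simp only [mul_assoc]⟩, _, rfl⟩

theorem pairsCollapse_of_cyclicLambda {G : Type*} [Group G]
    (h : ∀ (x : ℤ → G) (z : ℕ → G), (∀ i, x (i + 2) = x i) → (∀ n, z (n + 2) = z n) →
      ∃ n, ∀ i j, cyclicLambda 2 x z n i = cyclicLambda 2 x z n j) : PairsCollapse G := by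
  intro u v q
  let x : ℤ → G := fun i => if Even i then q.1 else q.2
  let z : ℕ → G := fun n => if Even n then u else v
  have hx : ∀ i, x (i + 2) = x i := fun i => by simp [x]
  have hz : ∀ n, z (n + 2) = z n := fun n => by simp [z, Nat.even_add]
  obtain ⟨n, hn⟩ := h x z hx hz
  refine ⟨n, ?_⟩
  have succ : ∀ n, (cyclicLambda 2 x z (n + 1) 0, cyclicLambda 2 x z (n + 1) 1)
      = pairStep (z n) (cyclicLambda 2 x z n 0, cyclicLambda 2 x z n 1) := by
    intro n
    have h2 : cyclicLambda 2 x z n 2 = cyclicLambda 2 x z n 0 :=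
      cyclicLambda_periodic (t := 2) hx z n 0
    have h3 : ∀ i, cyclicLambda 2 x z (n + 1) i
        = cyclicLambda 2 x z n i * z n * cyclicLambda 2 x z n (i + 1) := fun i => rfl
    rw [h3, h3, zero_add, one_add_one_eq_two, h2]
    rfl
  have key : ∀ n, (fun r => pairStep v (pairStep u r))^[n] q
      = (cyclicLambda 2 x z (2 * n) 0, cyclicLambda 2 x z (2 * n) 1) := by
    intro n
    induction n with
    | zero => simp [cyclicLambda, x]
    | succ n ih =>
      rw [Function.iterate_succ_apply', ih, show 2 * (n + 1) = 2 * n + 1 + 1 by ring, succ, succ]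
      simp [z]
  rw [key]
  exact cyclicLambda_const_of_le (by omega) hn 0 1

variable {M : Type*} [Monoid M] [Finite M] {I : Set M} {c : M} {t : ℕ} {x : ℤ → M} {z : ℕ → M}

theorem CollapsesPeriodically.isNilpotent_units (hC : CollapsesPeriodically I)
    (hI : ∀ a ∈ I, ∀ u, u * a ∈ I ∧ a * u ∈ I) {e : M} (he : e * e = e) (heI : e ∈ I) :
    Group.IsNilpotent (LocalMonoid e he)ˣ := by
  have : Finite (LocalMonoid e he) := Subtype.finite
  refine (pairsCollapse_of_cyclicLambda fun x z hx hz => ?_).isNilpotent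
  have hmem : ∀ g : (LocalMonoid e he)ˣ, unitsVal g ∈ I := fun g => by
    have := (hI e heI (unitsVal g)).2
    rwa [show e * unitsVal g = unitsVal g from g.1.2.1] at this
  obtain ⟨n, hn⟩ := hC 2 le_rfl (fun i => unitsVal (x i)) (fun k => unitsVal (z k))
    (fun i => hmem _) (fun k => hmem _) (fun i => congrArg _ (hx i)) (fun k => congrArg _ (hz k))
  refine ⟨n, fun i j => unitsVal_injective ?_⟩
  rw [map_cyclicLambda, map_cyclicLambda]
  exact hn i j

/-- If the `x_i` lie in one `H`-class and the `λ_{n,i}` stay in its `J`-class, then `a ↦ a z 0`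
turns the `λ_{n,i}` into elements formed in the same way in a maximal subgroup, which is nilpotent. -/
theorem CollapsesPeriodically.cyclicLambda_const_of_green (hC : CollapsesPeriodically I)
    (hI : ∀ a ∈ I, ∀ u, u * a ∈ I ∧ a * u ∈ I) (ht : 0 < t) (hx : ∀ i, x (i + t) = x i)
    (hcI : c ∈ I) (hxR : ∀ i, GreenR (x i) c) (hxL : ∀ i, GreenL (x i) c)
    (hz : ∀ n ≤ Nat.card M, GreenJ (c * z n * c) c) (i j : ℤ) :
    cyclicLambda t x z (Nat.card M) i = cyclicLambda t x z (Nat.card M) j := by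
  have hz0 := hz 0 (Nat.zero_le _)
  obtain ⟨v, hv⟩ : ∃ v, c = c * z 0 * c * v := by
    rw [mul_assoc] at hz0 ⊢
    exact hz0.greenR_mul.2
  -- The idempotent `e` in the group generated by `c * z 0`.
  obtain ⟨k, hk⟩ := exists_pow_mul_eq_self (a := c) (u := c * z 0) (w := v) hv.symm
  set g := c * z 0 with hg
  set e := g ^ (k + 1) with he_def
  have heg : e * g = g := by rw [hg, ← mul_assoc, ← hg, hk]
  have hge : g * e = g := ((Commute.refl g).pow_right (k + 1)).eq.trans heg
  have he : e * e = e := by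
    nth_rw 2 [he_def]
    rw [pow_succ', ← mul_assoc, heg, ← pow_succ']
  have heR : GreenR e c :=
    ⟨⟨z 0 * g ^ k, by rw [he_def, pow_succ', hg]; simp only [mul_assoc]⟩, c, hk.symm⟩
  have heI : e ∈ I := by
    obtain ⟨u, hu⟩ := heR.1
    exact hu ▸ (hI c hcI u).2
  have hnil := hC.isNilpotent_units hI he heI
  have : Finite (LocalMonoid e he) := Subtype.finite
  have eR : ∀ a, (∃ u, a = c * u) → e * a = a := by
    rintro _ ⟨u, rfl⟩
    rw [← mul_assoc, hk]
  have hX : ∀ i, ∃ g' : (LocalMonoid e he)ˣ, unitsVal g' = x i * z 0 := by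
    intro i
    refine exists_unitsVal_eq he ?_ ?_ ?_
    · rw [← mul_assoc, eR _ (hxR i).1]
    · obtain ⟨u, hu⟩ := (hxL i).1
      rw [hu, mul_assoc u, ← hg, mul_assoc, hge]
    · have h1 := greenJ_mul_congr (hxL i).symm (GreenR.refl c) hz0
      exact ((greenJ_of_mul (h1.trans (hxR i).greenJ.symm)).trans (hxR i).greenJ).trans
        heR.greenJ.symm
  choose X hX using hX
  obtain ⟨γ, hγ⟩ : ∃ γ : (LocalMonoid e he)ˣ, unitsVal γ = g := by
    refine exists_unitsVal_eq he heg hge ?_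
    exact (greenJ_of_mul hz0).trans heR.greenJ.symm
  have hZ : ∀ n ≤ Nat.card M, ∃ g' : (LocalMonoid e he)ˣ, unitsVal g' = c * z n * e := by
    intro n hn
    refine exists_unitsVal_eq he ?_ ?_ ?_
    · rw [← mul_assoc, ← mul_assoc, hk]
    · rw [mul_assoc, he]
    · exact (greenJ_mul_congr (GreenL.refl c) heR.symm (hz n hn)).trans heR.greenJ.symm
  choose! Z hZ using hZ
  have hγ' : g * unitsVal γ⁻¹ = e := by
    rw [← hγ, ← map_mul, mul_inv_cancel]
    rfl
  have hmul : ∀ n ≤ Nat.card M, ∀ a b, (∃ u, a = u * c) → (∃ u, b = c * u) →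
      a * z 0 * unitsVal (γ⁻¹ * Z n) * (b * z 0) = a * z n * b * z 0 := by
    rintro n hn a b ⟨u, rfl⟩ hb
    rw [map_mul, hZ n hn]
    calc u * c * z 0 * (unitsVal γ⁻¹ * (c * z n * e)) * (b * z 0)
        = u * (g * unitsVal γ⁻¹ * c) * z n * (e * b) * z 0 := by
          rw [hg]; simp only [mul_assoc]
      _ = u * c * z n * b * z 0 := by rw [hγ', hk, eR b hb]
  have hends : ∀ n i, (∃ u, cyclicLambda t x z n i = c * u) ∧
      ∃ u, cyclicLambda t x z n i = u * c := by
    intro n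
    induction n with
    | zero => exact fun i => ⟨(hxR i).1, (hxL i).1⟩
    | succ n ih =>
      intro i
      obtain ⟨⟨u, hu⟩, v, hv⟩ := exists_cyclicProd_eq (cyclicLambda t x z n) (z n) i (t - 1)
      obtain ⟨u', hu'⟩ := (ih i).1
      obtain ⟨v', hv'⟩ := (ih (i + (t - 1 : ℕ))).2
      rw [hu', mul_assoc] at hu
      rw [hv', ← mul_assoc] at hv
      exact ⟨⟨_, hu⟩, _, hv⟩
  have key : ∀ n ≤ Nat.card M, ∀ i,
      unitsVal (cyclicLambda t X (fun k => γ⁻¹ * Z k) n i) = cyclicLambda t x z n i * z 0 := by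
    intro n
    induction n with
    | zero => exact fun _ i => hX i
    | succ n ih =>
      intro hn i
      change unitsVal (cyclicProd _ _ i (t - 1)) = cyclicProd _ _ i (t - 1) * z 0
      generalize t - 1 = k
      induction k with
      | zero => exact ih (by omega) i
      | succ k ihk =>
        obtain ⟨u, hu⟩ := (exists_cyclicProd_eq (cyclicLambda t x z n) (z n) i k).2
        obtain ⟨u', hu'⟩ := (hends n (i + k)).2
        rw [cyclicProd, cyclicProd, map_mul, map_mul, ihk, ih (by omega)]
        exact hmul n (by omega) _ _ ⟨u * u', by rw [hu, hu', mul_assoc]⟩ (hends n _).1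
  have hcard : Nat.card (LocalMonoid e he)ˣ ≤ Nat.card M :=
    Nat.card_le_card_of_injective _ unitsVal_injective
  have hXper : ∀ i, X (i + t) = X i := fun i => unitsVal_injective (by rw [hX, hX, hx])
  refine cyclicLambda_const_of_le hcard (fun i j => ?_) i j
  have h1 := congrArg unitsVal
    (cyclicLambda_const_of_isNilpotent _ ht hXper (fun k => γ⁻¹ * Z k) i j)
  rw [key _ hcard, key _ hcard] at h1
  have cancel : ∀ i n, cyclicLambda t x z n i = cyclicLambda t x z n i * z 0 * c * v := by
    intro i n
    obtain ⟨u, hu⟩ := (hends n i).2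
    rw [hu]
    calc u * c = u * (g * c * v) := by rw [← hv]
      _ = _ := by rw [hg]; simp only [mul_assoc]
  rw [cancel i, cancel j, h1]

end GroupCollapse

/-! ### A uniform bound -/

section Bound

variable {M : Type*} [Monoid M]

theorem exists_cyclicProd_eq_mul_mul (a : ℤ → M) (w : M) (i : ℤ) {k l : ℕ} (h : l ≤ k) :
    ∃ u v, cyclicProd a w i k = u * a (i + l) * v := by
  induction k, h using Nat.le_induction with
  | base =>
    obtain ⟨-, u, hu⟩ := exists_cyclicProd_eq a w i l
    exact ⟨u, 1, by rw [hu, mul_one]⟩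
  | succ k _ ih =>
    obtain ⟨u, v, h⟩ := ih
    exact ⟨u, v * w * a (i + (k + 1 : ℕ)), by rw [cyclicProd, h]; simp only [mul_assoc]⟩

theorem exists_cyclicProd_eq_first_mul (a : ℤ → M) (w : M) (i : ℤ) {k : ℕ} (h : 1 ≤ k) :
    ∃ u, cyclicProd a w i k = a i * (w * a (i + 1)) * u := by
  induction k, h using Nat.le_induction with
  | base => exact ⟨1, by simp [cyclicProd, mul_assoc]⟩
  | succ k _ ih =>
    obtain ⟨u, h⟩ := ih
    exact ⟨u * w * a (i + (k + 1 : ℕ)), by rw [cyclicProd, h]; simp only [mul_assoc]⟩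

variable {I : Set M} {c : M} {t : ℕ} {x : ℤ → M} {z : ℕ → M}

theorem exists_cyclicLambda_eq_mul_mul (ht : 0 < t) (hx : ∀ i, x (i + t) = x i) {n m : ℕ}
    (h : n < m) (i j : ℤ) :
    ∃ u v, cyclicLambda t x z m i = u * cyclicLambda t x z n j * v := by
  induction m, h using Nat.le_induction generalizing i with
  | base =>
    have h1 := Int.emod_lt_of_pos (j - i) (Int.natCast_pos.mpr ht)
    have h2 := Int.emod_nonneg (j - i) (show (t : ℤ) ≠ 0 by omega)
    obtain ⟨u, v, huv⟩ := exists_cyclicProd_eq_mul_mul (cyclicLambda t x z n) (z n) i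
      (k := t - 1) (l := ((j - i) % t).toNat) (by omega)
    refine ⟨u, v, ?_⟩
    rw [eq_of_int_modEq (cyclicLambda_periodic hx z n) (i := j)
      (j := i + ((j - i) % t).toNat) ?_]
    · exact huv
    · rw [Int.toNat_of_nonneg h2]
      have := Int.mul_ediv_add_emod (j - i) t
      exact ⟨-((j - i) / t), by linarith⟩
  | succ m _ ih =>
    obtain ⟨u, v, huv⟩ := ih i
    obtain ⟨⟨w, hw⟩, -⟩ := exists_cyclicProd_eq (cyclicLambda t x z m) (z m) i (t - 1)
    refine ⟨u, v * w, ?_⟩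
    change cyclicProd _ _ _ _ = _
    rw [hw, huv, mul_assoc]

theorem cyclicLambda_mem (hI : ∀ a ∈ I, ∀ u, u * a ∈ I ∧ a * u ∈ I) (hxI : ∀ i, x i ∈ I) (n : ℕ)
    (i : ℤ) : cyclicLambda t x z n i ∈ I := by
  induction n with
  | zero => exact hxI i
  | succ n ih =>
    obtain ⟨⟨w, hw⟩, -⟩ := exists_cyclicProd_eq (cyclicLambda t x z n) (z n) i (t - 1)
    change cyclicProd _ _ _ _ ∈ I
    rw [hw]
    exact (hI _ ih w).2

variable [Finite M]

/-- If the `λ_{n,i}` stay in one `J`-class for long enough, they become equal. -/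
theorem CollapsesPeriodically.cyclicLambda_const_of_greenJ (hC : CollapsesPeriodically I)
    (hI : ∀ a ∈ I, ∀ u, u * a ∈ I ∧ a * u ∈ I) (hI1 : ∀ a, a ∉ I → a = 1) (ht : 2 ≤ t)
    (hx : ∀ i, x (i + t) = x i) (hxI : ∀ i, x i ∈ I)
    (hJ : ∀ n ≤ Nat.card M + 2, ∀ i, GreenJ (cyclicLambda t x z n i) c) (i j : ℤ) :
    cyclicLambda t x z (Nat.card M) i = cyclicLambda t x z (Nat.card M) j := by
  have hc : ∀ i, GreenJ (x i) c := hJ 0 (Nat.zero_le _)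
  have hRL : ∀ n ≤ Nat.card M + 2, ∀ i, GreenR (cyclicLambda t x z n i) (x i) ∧
      GreenL (cyclicLambda t x z n i) (x (i - n)) := by
    intro n
    induction n with
    | zero => exact fun _ i => ⟨GreenR.refl _, by simpa [cyclicLambda] using GreenL.refl (x i)⟩
    | succ n ih =>
      intro hn i
      have hn' : n ≤ Nat.card M + 2 := by omega
      obtain ⟨⟨u, hu⟩, v, hv⟩ := exists_cyclicProd_eq (cyclicLambda t x z n) (z n) i (t - 1)
      have hJ' := hJ (n + 1) hn i
      change GreenJ (cyclicProd _ _ _ _) c at hJ'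
      change GreenR (cyclicProd _ _ _ _) _ ∧ GreenL (cyclicProd _ _ _ _) _
      constructor
      · rw [hu] at hJ' ⊢
        exact (hJ'.trans (hJ n hn' _).symm).greenR_mul.trans (ih hn' i).1
      · rw [hv] at hJ' ⊢
        have h1 := (hJ'.trans (hJ n hn' _).symm).greenL_mul.trans (ih hn' _).2
        rwa [eq_of_int_modEq hx (i := i + (t - 1 : ℕ) - n) (j := i - (n + 1 : ℕ))
          ⟨-1, by push_cast [show 1 ≤ t by omega]; ring⟩] at h1
  have hxz : ∀ n : ℕ, n < Nat.card M + 2 → ∀ i : ℤ, GreenJ (x i * z n * x (i + n + 1)) c := by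
    intro n hn i
    obtain ⟨u, hu⟩ := exists_cyclicProd_eq_first_mul (cyclicLambda t x z n) (z n) (i + n)
      (k := t - 1) (by omega)
    have h1 := hJ (n + 1) hn (i + n)
    change GreenJ (cyclicProd _ _ _ _) c at h1
    rw [hu] at h1
    have h2 := (greenJ_of_mul (h1.trans (hJ n hn.le _).symm)).trans (hJ n hn.le _)
    rw [← mul_assoc] at h2
    have h3 := (hRL n hn.le (i + n)).2
    rw [add_sub_cancel_right] at h3
    exact greenJ_mul_congr h3 (hRL n hn.le _).1 h2
  have hH := hC.green_of_products hI hI1 (by omega) hx hxI hc hxz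
  refine hC.cyclicLambda_const_of_green hI (by omega) hx (hxI 0) (fun i => (hH i 0).1)
    (fun i => (hH i 0).2) (fun n hn => ?_) i j
  exact greenJ_mul_congr (GreenL.refl _) (hH _ 0).1 ((hxz n (by omega) 0).trans (hc 0).symm)

/-- The `J`-class of `λ_{n,0}` descends at most `|M|` times, which leaves a long block of indices
`n` in which it does not change. -/
theorem CollapsesPeriodically.exists_bound (hC : CollapsesPeriodically I)
    (hI : ∀ a ∈ I, ∀ u, u * a ∈ I ∧ a * u ∈ I) (hI1 : ∀ a, a ∉ I → a = 1) :
    ∃ n : ℕ, 0 < n ∧ ∀ t : ℕ, 0 < t → ∀ (x : ℤ → M) (z : ℕ → M), (∀ i, x (i + t) = x i) →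
      (∀ i, x i ∈ I) → ∀ i j, cyclicLambda t x z n i = cyclicLambda t x z n j := by
  set K := Nat.card M with hK
  refine ⟨(K + 1) * (K + 4), by positivity, fun t ht x z hx hxI => ?_⟩
  obtain rfl | ht2 : t = 1 ∨ 2 ≤ t := by omega
  · exact fun i j => eq_of_int_modEq (cyclicLambda_periodic hx z _) (by simp)
  let ideal : ℕ → Set M := fun k =>
    {m | ∃ u v, m = u * cyclicLambda t x z (k * (K + 4)) 0 * v}
  have hanti : ∀ k, ideal (k + 1) ⊆ ideal k := by
    rintro k _ ⟨u, v, rfl⟩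
    obtain ⟨u', v', h⟩ := exists_cyclicLambda_eq_mul_mul (z := z) ht hx
      (show k * (K + 4) < (k + 1) * (K + 4) by nlinarith) 0 0
    exact ⟨u * u', v' * v, by rw [h]; simp only [mul_assoc]⟩
  obtain ⟨k, hk, heq⟩ : ∃ k ≤ K, ideal k ⊆ ideal (k + 1) := by
    by_contra! hne
    have hlt : ∀ k ≤ K + 1, (ideal k).ncard + k ≤ K := by
      intro k
      induction k with
      | zero => exact fun _ => Set.ncard_le_card _
      | succ k ih =>
        intro hk
        have h1 := Set.ncard_lt_ncard ((hanti k).ssubset_of_not_subset (hne k (by omega)))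
          (Set.toFinite _)
        have h2 := ih (by omega)
        omega
    have := hlt (K + 1) le_rfl
    omega
  obtain ⟨u, v, huv⟩ : cyclicLambda t x z (k * (K + 4)) 0 ∈ ideal (k + 1) :=
    heq ⟨1, 1, by simp⟩
  have hJ : ∀ n m, k * (K + 4) < n → n < (k + 1) * (K + 4) → k * (K + 4) < m →
      m < (k + 1) * (K + 4) → ∀ i j, ∃ p q,
        cyclicLambda t x z n i = p * cyclicLambda t x z m j * q := by
    intro n m hn _ _ hm i j
    obtain ⟨p, q, h1⟩ := exists_cyclicLambda_eq_mul_mul (z := z) ht hx hn i 0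
    obtain ⟨p', q', h2⟩ := exists_cyclicLambda_eq_mul_mul (z := z) ht hx hm 0 j
    rw [huv, h2] at h1
    exact ⟨p * u * p', q' * v * q, by rw [h1]; simp only [mul_assoc]⟩
  have hblock := hC.cyclicLambda_const_of_greenJ hI hI1 ht2
    (x := cyclicLambda t x z (k * (K + 4) + 1)) (z := fun n => z (k * (K + 4) + 1 + n))
    (c := cyclicLambda t x z (k * (K + 4) + 1) 0)
    (cyclicLambda_periodic hx z _) (cyclicLambda_mem hI hxI _) (fun n hn i => by
      rw [← cyclicLambda_add]
      rw [← hK] at hn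
      have h1 : k * (K + 4) + 1 + n < (k + 1) * (K + 4) := by nlinarith
      exact ⟨hJ _ _ (by omega) h1 (by omega) (by omega) _ _,
        hJ _ _ (by omega) (by omega) (by omega) h1 _ _⟩)
  rw [← cyclicLambda_add, ← hK] at hblock
  refine cyclicLambda_const_of_le ?_ hblock
  nlinarith [Nat.mul_le_mul_right (K + 4) hk]

end Bound

/-! ### The pseudoidentities -/

section Pseudoidentities

theorem map_malcevLambda {M N : Type*} [Semigroup M] [Semigroup N] (f : M →ₙ* N) {t : ℕ}
    (x : Fin t → M) (n : ℕ) (z : Fin n → M) (i : Fin t) :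
    f (malcevLambda x n z i) = malcevLambda (fun k => f (x k)) n (fun k => f (z k)) i := by
  induction n generalizing i with
  | zero => rfl
  | succ n ih =>
    have key : ∀ (a : Fin t → M) (w : M) (k : ℕ),
        f (interleave a w i k) = interleave (fun j => f (a j)) (f w) i k := by
      intro a w k
      induction k with
      | zero => rfl
      | succ k ihk => simp [interleave, ihk]
    simp only [malcevLambda, key, ih]

namespace FreeProfiniteSemigroup

variable {A : Type u} {S : Type v} [Semigroup S] [Finite S]

theorem eventually_eval_omegaPow [Finite A] (f : A → FreeProfiniteSemigroup A) (ψ : A → S)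
    (x : FreeProfiniteSemigroup A) : ∀ᶠ n : ℕ in Filter.atTop,
      eval ψ (omegaPow (lift f) x) = eval ψ ((lift f)^[n.factorial] x) := by
  have := tendsto_omegaPow (lift f) (continuous_lift f) x
  filter_upwards [this (proj_mem_nhds _ (kerCon ψ))] with n hn
  have hn' : ((lift f)^[n.factorial] x).proj (kerCon ψ)
    = (omegaPow (lift f) x).proj (kerCon ψ) := hn
  change evalFun ψ _ = evalFun ψ _
  rw [evalFun, evalFun, hn']

theorem eval_lift_iterate (f : A → FreeProfiniteSemigroup A) (ψ : A → S)
    (x : FreeProfiniteSemigroup A) (k : ℕ) :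
    eval ψ ((lift f)^[k] x) = eval ((fun (g : A → S) a => eval g (f a))^[k] ψ) x := by
  induction k generalizing ψ with
  | zero => rfl
  | succ k ih =>
    rw [Function.iterate_succ_apply', eval_lift, ih, Function.iterate_succ_apply]

/-- Evaluation after `k` applications of `φ_t` amounts to `t k` steps of the recursion for `λ_{n,i}`,
with the values of `z_1, …, z_t` repeated periodically. -/
theorem eval_malcevEndo_iterate {t : ℕ} (ht : 0 < t) (ψ : Fin t ⊕ Fin t → S) (k : ℕ) (i : Fin t) :
    eval ψ ((malcevEndo t)^[k] (of (Sum.inl i)))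
      = cyclicLambda t (periodicExt ht fun j => ψ (Sum.inl j))
          (fun n => ψ (Sum.inr ⟨n % t, Nat.mod_lt _ ht⟩)) (t * k) ((i : ℕ) : ℤ) := by
  rw [malcevEndo, eval_lift_iterate, eval_of]
  set T : (Fin t ⊕ Fin t → S) → Fin t ⊕ Fin t → S := fun g a => eval g (Sum.elim
    (malcevLambda (fun i => of (Sum.inl i)) t fun i => of (Sum.inr i))
    (fun i => of (Sum.inr i)) a) with hT
  set z : ℕ → S := fun n => ψ (Sum.inr ⟨n % t, Nat.mod_lt _ ht⟩) with hz
  have key : ∀ k, (∀ j, T^[k] ψ (Sum.inr j) = ψ (Sum.inr j)) ∧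
      ∀ j, periodicExt ht (fun j => T^[k] ψ (Sum.inl j)) j
        = cyclicLambda t (periodicExt ht fun j => ψ (Sum.inl j)) z (t * k) j := by
    intro k
    induction k with
    | zero => exact ⟨fun _ => rfl, fun _ => rfl⟩
    | succ k ih =>
      rw [Function.iterate_succ_apply']
      refine ⟨fun j => by rw [hT]; simpa using ih.1 j, fun j => ?_⟩
      have h1 : (fun j => T (T^[k] ψ) (Sum.inl j))
          = malcevLambda (fun j => T^[k] ψ (Sum.inl j)) t (fun n : Fin t => z n) := by
        funext j
        rw [hT]
        simp only [Sum.elim_inl, map_malcevLambda, eval_of]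
        congr 1
        funext n
        rw [hz]
        simp only [Nat.mod_eq_of_lt n.2]
        exact ih.1 n
      have h2 : z = fun n => z (t * k + n) := by
        funext n
        simp [hz]
      rw [h1, periodicExt_malcevLambda, funext ih.2, mul_add, mul_one, cyclicLambda_add, ← h2]
  rw [← (key k).2, periodicExt_coe]

end FreeProfiniteSemigroup

open FreeProfiniteSemigroup

/-- Since `φ_t^ω` is a limit of powers of `φ_t`, and a constant tuple stays constant, the
pseudoidentities say that the `λ_{n,i}` for a periodic sequence `z` become equal. -/
theorem mem_SMNCirc_iff {S : FiniteSemigroup.{u}} {t : ℕ} (ht : 0 < t) :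
    S ∈ SMNCirc t ↔ ∀ (x : ℤ → S.carrier) (z : ℕ → S.carrier), (∀ i, x (i + t) = x i) →
      (∀ n, z (n + t) = z n) →
      ∃ n, ∀ i j, cyclicLambda t x z n i = cyclicLambda t x z n j := by
  constructor
  · intro hS x z hx hz
    let ψ : Fin t ⊕ Fin t → S.carrier := Sum.elim (fun i => x (i : ℕ)) (fun i => z i)
    have hxψ : (periodicExt ht fun j => ψ (Sum.inl j)) = x := by
      funext i
      refine eq_of_int_modEq hx ?_
      simp only
      rw [Int.toNat_of_nonneg (Int.emod_nonneg _ (by omega))]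
      exact Int.dvd_self_sub_emod
    have hzψ : (fun n => ψ (Sum.inr ⟨n % t, Nat.mod_lt _ ht⟩)) = z := by
      funext n
      exact (show Function.Periodic z t from hz).map_mod_nat n
    have hev : ∀ i : Fin t, ∀ᶠ n : ℕ in Filter.atTop,
        eval ψ (omegaPow (malcevEndo t) (of (Sum.inl i)))
          = cyclicLambda t x z (t * n.factorial) ((i : ℕ) : ℤ) := by
      intro i
      filter_upwards [eventually_eval_omegaPow _ ψ (of (Sum.inl i))] with n hn
      refine hn.trans ?_
      have := eval_malcevEndo_iterate ht ψ n.factorial i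
      rwa [hxψ, hzψ] at this
    obtain ⟨n, hn⟩ := (Filter.eventually_all.mpr hev).exists
    refine ⟨t * n.factorial, fun i j => ?_⟩
    have hrep : ∀ i : ℤ, ∃ k : Fin t, cyclicLambda t x z (t * n.factorial) i
        = cyclicLambda t x z (t * n.factorial) ((k : ℕ) : ℤ) := by
      intro i
      have h1 := Int.emod_lt_of_pos i (Int.natCast_pos.mpr ht)
      have h2 := Int.emod_nonneg i (show (t : ℤ) ≠ 0 by omega)
      refine ⟨⟨(i % t).toNat, by omega⟩, (eq_of_int_modEq (cyclicLambda_periodic hx z _) ?_).symm⟩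
      simp only
      rw [Int.toNat_of_nonneg h2]
      exact Int.dvd_self_sub_emod
    obtain ⟨k, hk⟩ := hrep i
    obtain ⟨l, hl⟩ := hrep j
    rw [hk, hl, ← hn, ← hn]
    exact hS _ ⟨k, l, rfl⟩ ψ
  · rintro hS _ ⟨i, j, rfl⟩ ψ
    obtain ⟨n, hn⟩ := hS (periodicExt ht fun j => ψ (Sum.inl j))
      (fun n => ψ (Sum.inr ⟨n % t, Nat.mod_lt _ ht⟩)) (periodicExt_periodic ht _)
      (fun n => by simp)
    have hev := fun i => eventually_eval_omegaPow
      (Sum.elim (malcevLambda (fun i => of (Sum.inl i)) t fun i => of (Sum.inr i))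
        fun i => of (Sum.inr i)) ψ (of (Sum.inl i))
    obtain ⟨m, ⟨hi, hj⟩, hm⟩ :=
      (((hev i).and (hev j)).and (Filter.eventually_ge_atTop n)).exists
    refine hi.trans (Eq.trans ?_ hj.symm)
    refine (eval_malcevEndo_iterate ht ψ _ i).trans
      (Eq.trans ?_ (eval_malcevEndo_iterate ht ψ _ j).symm)
    refine cyclicLambda_const_of_le ?_ hn _ _
    exact (hm.trans (Nat.self_le_factorial m)).trans (Nat.le_mul_of_pos_left _ ht)

end Pseudoidentities

theorem mainTheorem3 : SMN.{u} = ⋂ (t : ℕ) (_ : 2 ≤ t), SMNCirc.{u} t := by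
  ext S
  simp only [Set.mem_iInter]
  constructor
  · rintro ⟨n, -, hn⟩ t ht
    rw [mem_SMNCirc_iff (by omega)]
    intro x z hx _
    have ht0 : 0 < t := by omega
    refine ⟨n, fun i j => WithOne.coe_injective ?_⟩
    have h1 : ∀ i, ((cyclicLambda t x z n i : S.carrier) : WithOne S.carrier)
        = periodicExt ht0 (malcevLambda
            (fun k : Fin t => ((x (k : ℕ) : S.carrier) : WithOne S.carrier)) n
            fun k : Fin n => ((z k : S.carrier) : WithOne S.carrier)) i := by
      intro i
      refine (map_cyclicLambda (WithOne.coeMulHom : S.carrier →ₙ* _) t x z n i).trans ?_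
      rw [periodicExt_malcevLambda ht0 _ (fun k => ((z k : S.carrier) : WithOne S.carrier))]
      have hxe : (fun j => (WithOne.coeMulHom : S.carrier →ₙ* _) (x j))
          = periodicExt ht0 (fun k : Fin t => ((x (k : ℕ) : S.carrier) : WithOne S.carrier)) := by
        funext i
        refine congrArg WithOne.coe (eq_of_int_modEq hx ?_)
        simp only
        rw [Int.toNat_of_nonneg (Int.emod_nonneg _ (by omega))]
        exact dvd_sub_comm.mp Int.dvd_self_sub_emod
      rw [hxe]
      rfl
    rw [h1, h1]
    exact hn t _ _ _ _
  · intro hS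
    let I : Set (WithOne S.carrier) := Set.range WithOne.coe
    have hI : ∀ a ∈ I, ∀ u, u * a ∈ I ∧ a * u ∈ I := by
      rintro _ ⟨a, rfl⟩ u
      cases u with
      | one => simp [I]
      | coe u => exact ⟨⟨u * a, by simp⟩, ⟨a * u, by simp⟩⟩
    have hI1 : ∀ a, a ∉ I → a = 1 := by
      intro a ha
      cases a with
      | one => rfl
      | coe a => exact absurd ⟨a, rfl⟩ ha
    have hC : CollapsesPeriodically I := by
      intro m hm x z hxI hzI hx hz
      choose x' hx' using hxI
      choose z' hz' using hzI
      obtain ⟨n, hn⟩ := (mem_SMNCirc_iff (by omega)).mp (hS m hm) x' z'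
        (fun i => WithOne.coe_injective (by rw [hx', hx', hx]))
        (fun i => WithOne.coe_injective (by rw [hz', hz', hz]))
      obtain rfl : (fun i => (x' i : WithOne S.carrier)) = x := funext hx'
      obtain rfl : (fun i => (z' i : WithOne S.carrier)) = z := funext hz'
      refine ⟨n, fun i j => ?_⟩
      have h1 := map_cyclicLambda (WithOne.coeMulHom : S.carrier →ₙ* _) m x' z' n
      exact (h1 i).symm.trans ((congrArg _ (hn i j)).trans (h1 j))
    have : Finite (WithOne S.carrier) := inferInstanceAs (Finite (Option S.carrier))
    obtain ⟨n, hn0, hn⟩ := hC.exists_bound hI hI1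
    refine ⟨n, hn0, fun t x z i j => ?_⟩
    have ht : 0 < t := i.pos
    have hz : z = fun k : Fin n =>
        (fun k : ℕ => if h : k < n then z ⟨k, h⟩ else 1) (k : ℕ) := by
      funext k
      simp
    rw [hz, malcevLambda_eq_cyclicLambda ht _ (fun k : ℕ => if h : k < n then z ⟨k, h⟩ else 1),
      malcevLambda_eq_cyclicLambda ht _ (fun k : ℕ => if h : k < n then z ⟨k, h⟩ else 1)]
    exact hn t ht _ _ (periodicExt_periodic ht _) (fun i => ⟨_, rfl⟩) _ _
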